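/- All monoids are commutative. For a monoid $A$, let $\operatorname{Spec}\mathbb F_A$ be the set of prime ideals of $A$ (proper, possibly empty subsets $\mathfrak p$ with $\mathfrak pA\subseteq\mathfrak p$ such that $xy\in\mathfrak p$ implies $x\in\mathfrak p$ or $y\in\mathfrak p$), with closed sets $V(\mathfrak a)=\{\mathfrak p\supseteq\mathfrak a\}$ for ideals $\mathfrak a$ of $A$, and with the sheaf of monoids $\mathcal O$ whose sections over an open set $U$ are the families $(s(\mathfrak p)\in A_{\mathfrak p})_{\mathfrak p\in U}$ that are locally of the form $a/f$ with $a,f\in A$. A scheme over $\mathbb F_1$ is a topological space with a sheaf of monoids that is locally isomorphic to such a spectrum. A morphism $f\colon X\to Y$ of schemes over $\mathbb F_1$ is a continuous map with a morphism of sheaves of monoids $\mathcal O_Y\to f_*\mathcal O_X$ such that, on each stalk $\mathcal O_{Y,f(x)}\to\mathcal O_{X,x}$, the preimage of the invertible elements is exactly the set of invertible elements. Put $X(\mathbb F_A)=\operatorname{Hom}(\operatorname{Spec}\mathbb F_A,X)$. For a scheme $X$ over $\mathbb F_1$, let $X\otimes_{\mathbb F_1}\mathbb Z$ be the scheme obtained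 by gluing the affine schemes $\operatorname{Spec}\mathbb Z[\mathcal O_X(U)]$, for $U\subseteq X$ affine open, along the inclusions of affine open subsets of $X$ (here $\mathbb Z[A]$ is the monoid ring), and let $X\otimes_{\mathbb F_1}\mathbb F_p=(X\otimes_{\mathbb F_1}\mathbb Z)\times_{\operatorname{Spec}\mathbb Z}\operatorname{Spec}\mathbb F_p$. **Proposition.** Let $p$ be a prime and let $X$ be a scheme over $\mathbb F_1$ such that for every $n\ge 1$ the set $X((\mathbb F_{p^n},\times))$ of points of $X$ with values in the multiplicative monoid of the field $\mathbb F_{p^n}$ is finite. Then the set $(X\otimes_{\mathbb F_1}\mathbb F_p)(\mathbb F_{p^n})$ of morphisms $\operatorname{Spec}\mathbb F_{p^n}\to X\otimes_{\mathbb F_1}\mathbb F_p$ over $\mathbb F_p$ is finite for every $n\ge 1$, and the formal power series $$Z_X(p,T)=\exp\Bigl(\sum_{n\ge 1}\frac{T^n}{n}\,\#X((\mathbb F_{p^n},\times))\Bigr)$$ coincides with the Hasse–Weil zeta function $$Z(X\otimes_{\mathbb F_1}\mathbb F_p,T)=\exp\Bigl(\sum_{n\ge 1}\frac{T^n}{n}\,\#(X\otimes_{\mathbb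 F_1}\mathbb F_p)(\mathbb F_{p^n})\Bigr).$$ -/

import Mathlib

open CategoryTheory Opposite TopologicalSpace AlgebraicGeometry

universe u

namespace FOne

noncomputable section

/-! ### The spectrum of a commutative monoid -/

/-- A prime ideal of a commutative monoid `A`: an ideal `𝔭 ≠ A` (a subset with `𝔭A ⊆ 𝔭`, possibly
empty) such that `xy ∈ 𝔭` implies `x ∈ 𝔭` or `y ∈ 𝔭`. -/
@[ext]
structure PrimeIdeal (A : Type u) [CommMonoid A] where
  asIdeal : SemigroupIdeal A
  ne_top : asIdeal ≠ ⊤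
  mem_or_mem : ∀ {x y : A}, x * y ∈ asIdeal → x ∈ asIdeal ∨ y ∈ asIdeal

namespace PrimeIdeal

variable {A B : Type u} [CommMonoid A] [CommMonoid B]

theorem mul_mem_left (p : PrimeIdeal A) (a : A) {b : A} (h : b ∈ p.asIdeal) :
    a * b ∈ p.asIdeal :=
  SemigroupIdeal.mul_mem p.asIdeal a h

theorem mul_mem_right (p : PrimeIdeal A) {a : A} (b : A) (h : a ∈ p.asIdeal) :
    a * b ∈ p.asIdeal :=
  mul_comm b a ▸ p.mul_mem_left b h

theorem one_notMem (p : PrimeIdeal A) : (1 : A) ∉ p.asIdeal := fun h =>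
  p.ne_top (SetLike.ext fun a => ⟨fun _ => trivial, fun _ => by
    simpa using p.mul_mem_left a h⟩)

/-- The complement `S_𝔭 = A ∖ 𝔭`, a submonoid. -/
def primeCompl (p : PrimeIdeal A) : Submonoid A where
  carrier := {a | a ∉ p.asIdeal}
  one_mem' := p.one_notMem
  mul_mem' ha hb h := (p.mem_or_mem h).elim ha hb

theorem mem_primeCompl {p : PrimeIdeal A} {a : A} : a ∈ p.primeCompl ↔ a ∉ p.asIdeal := Iff.rfl

/-- Constructor from the complement, a submonoid closed under divisors. -/
def ofCompl (S : Submonoid A) (hS : ∀ a b : A, a * b ∈ S → b ∈ S) : PrimeIdeal A where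
  asIdeal := { carrier := {a | a ∉ S}, smul_mem' := fun c _ hx h => hx (hS c _ h) }
  ne_top h := by
    have : (1 : A) ∈ (⊤ : SemigroupIdeal A) := trivial
    rw [← h] at this
    exact this S.one_mem
  mem_or_mem {x y} h := by
    by_contra hc
    push Not at hc
    exact h (S.mul_mem (not_not.mp hc.1) (not_not.mp hc.2))

theorem mem_ofCompl {S : Submonoid A} {hS : ∀ a b : A, a * b ∈ S → b ∈ S} {a : A} :
    a ∈ (ofCompl S hS).asIdeal ↔ a ∉ S := Iff.rfl

/-- The preimage `φ⁻¹(𝔮)` of a prime ideal. -/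
def comap (φ : A →* B) (q : PrimeIdeal B) : PrimeIdeal A :=
  ofCompl (q.primeCompl.comap φ) fun a b h => by
    rw [Submonoid.mem_comap, map_mul] at h
    exact fun hb => h (q.mul_mem_left _ hb)

theorem mem_comap {φ : A →* B} {q : PrimeIdeal B} {a : A} :
    a ∈ (comap φ q).asIdeal ↔ φ a ∈ q.asIdeal := not_not

/-- `V(𝔞)`, the set of prime ideals containing the ideal `𝔞`. -/
def zeroLocus (I : SemigroupIdeal A) : Set (PrimeIdeal A) := {p | I ≤ p.asIdeal}

/-- The topology of `Spec A`, whose closed sets are the sets `V(𝔞)`. (The empty set is `V(A)`.) -/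
instance : TopologicalSpace (PrimeIdeal A) :=
  TopologicalSpace.ofClosed (Set.range (zeroLocus (A := A)))
    ⟨⊤, Set.eq_empty_of_forall_notMem fun p hp => p.ne_top (top_le_iff.mp hp)⟩
    (by
      intro T hT
      choose! I hI using fun t (ht : t ∈ T) => hT ht
      refine ⟨⨆ t ∈ T, I t, ?_⟩
      ext p
      simp only [zeroLocus, Set.mem_ofPred_eq, iSup_le_iff, Set.mem_sInter]
      exact forall₂_congr fun t ht => by conv_rhs => rw [← hI t ht]
                                         rfl)
    (by
      rintro _ ⟨I, rfl⟩ _ ⟨J, rfl⟩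
      refine ⟨I ⊓ J, ?_⟩
      ext p
      simp only [zeroLocus, Set.mem_ofPred_eq, Set.mem_union]
      constructor
      · intro h
        by_contra hc
        push Not at hc
        obtain ⟨⟨a, ha, ha'⟩, ⟨b, hb, hb'⟩⟩ :=
          And.intro (SetLike.not_le_iff_exists.mp hc.1) (SetLike.not_le_iff_exists.mp hc.2)
        rcases p.mem_or_mem (h (show a * b ∈ I ⊓ J from
          ⟨mul_comm b a ▸ SemigroupIdeal.mul_mem I b ha, SemigroupIdeal.mul_mem J a hb⟩)) with h | h
        · exact ha' h
        · exact hb' h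
      · rintro (h | h)
        · exact inf_le_left.trans h
        · exact inf_le_right.trans h)

theorem isClosed_iff {Z : Set (PrimeIdeal A)} : IsClosed Z ↔ ∃ I, zeroLocus I = Z := by
  rw [← isOpen_compl_iff]
  change Zᶜᶜ ∈ Set.range zeroLocus ↔ _
  rw [compl_compl, Set.mem_range]

/-- The set `D(f)` of prime ideals not containing `f`. -/
def basicOpen (f : A) : Opens (PrimeIdeal A) where
  carrier := {p | f ∉ p.asIdeal}
  is_open' := by
    rw [← isClosed_compl_iff, isClosed_iff]
    refine ⟨SemigroupIdeal.closure {f}, ?_⟩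
    ext p
    simp [zeroLocus, SemigroupIdeal.closure_le]

theorem mem_basicOpen {f : A} {p : PrimeIdeal A} : p ∈ basicOpen f ↔ f ∉ p.asIdeal := Iff.rfl

theorem exists_basicOpen {U : Opens (PrimeIdeal A)} {p : PrimeIdeal A} (hp : p ∈ U) :
    ∃ f, p ∈ basicOpen f ∧ basicOpen f ≤ U := by
  obtain ⟨I, hI⟩ := isClosed_iff.mp (isClosed_compl_iff.mpr U.isOpen)
  have hpI : ¬ I ≤ p.asIdeal := fun h => (hI ▸ h : p ∈ (U : Set (PrimeIdeal A))ᶜ) hp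
  obtain ⟨f, hf, hfp⟩ := SetLike.not_le_iff_exists.mp hpI
  refine ⟨f, hfp, fun q hq => ?_⟩
  by_contra hqU
  have : q ∈ zeroLocus I := hI ▸ hqU
  exact hq (this hf)

/-- Open sets are stable under passing to smaller prime ideals. -/
theorem mem_of_le {U : Opens (PrimeIdeal A)} {p q : PrimeIdeal A} (hp : p ∈ U)
    (h : q.asIdeal ≤ p.asIdeal) : q ∈ U := by
  obtain ⟨f, hf, hfU⟩ := exists_basicOpen hp
  exact hfU fun hq => hf (h hq)

/-- The largest prime ideal not containing `f`: its complement consists of the divisors of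
powers of `f`. -/
def maxAway (f : A) : PrimeIdeal A :=
  ofCompl
    { carrier := {a | ∃ n : ℕ, a ∣ f ^ n}
      one_mem' := ⟨0, one_dvd _⟩
      mul_mem' := fun ⟨n, hn⟩ ⟨m, hm⟩ => ⟨n + m, pow_add f n m ▸ mul_dvd_mul hn hm⟩ }
    fun _ _ ⟨n, hn⟩ => ⟨n, (Dvd.intro_left _ rfl).trans hn⟩

theorem notMem_maxAway {f a : A} : a ∉ (maxAway f).asIdeal ↔ ∃ n : ℕ, a ∣ f ^ n := not_not

theorem maxAway_mem (f : A) : maxAway f ∈ basicOpen f :=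
  notMem_maxAway.mpr ⟨1, by simp⟩

theorem pow_notMem (p : PrimeIdeal A) {f : A} (hf : f ∉ p.asIdeal) (n : ℕ) :
    f ^ n ∉ p.asIdeal := p.primeCompl.pow_mem hf n

theorem le_maxAway {f : A} {q : PrimeIdeal A} (hq : q ∈ basicOpen f) :
    q.asIdeal ≤ (maxAway f).asIdeal := by
  intro a ha
  by_contra h
  obtain ⟨n, c, hc⟩ := notMem_maxAway.mp h
  exact q.pow_notMem hq n (hc ▸ q.mul_mem_right c ha)

theorem basicOpen_le {f : A} {U : Opens (PrimeIdeal A)} (h : maxAway f ∈ U) : basicOpen f ≤ U :=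
  fun _ hq => mem_of_le h (le_maxAway hq)

theorem continuous_comap (φ : A →* B) : Continuous (comap φ) := by
  refine continuous_iff_isClosed.mpr fun Z hZ => ?_
  obtain ⟨I, rfl⟩ := isClosed_iff.mp hZ
  refine isClosed_iff.mpr ⟨SemigroupIdeal.closure (φ '' I), ?_⟩
  ext q
  simp only [zeroLocus, SemigroupIdeal.closure_le, Set.image_subset_iff]
  exact forall₂_congr fun a _ => mem_comap.symm

end PrimeIdeal

/-! ### The structure sheaf -/

section StructureSheaf

variable (A : Type u) [CommMonoid A]

/-- The underlying space of `Spec A`. -/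
def specTop : TopCat.{u} := TopCat.of (PrimeIdeal A)

/-- The local predicate on families `s(𝔭) ∈ A_𝔭` (`𝔭 ∈ U`): each point of `U` has a neighbourhood
`V ⊆ U` and `a, f ∈ A` such that for all `𝔮 ∈ V` one has `f ∉ 𝔮` and `s(𝔮) = a / f`. -/
def isLocallyFraction :
    TopCat.LocalPredicate fun p : specTop A => Localization (PrimeIdeal.primeCompl p) :=
  TopCat.PrelocalPredicate.sheafify
    { pred := fun {U} s => ∃ a f : A, ∀ q : U,
        ∃ hf : f ∉ PrimeIdeal.asIdeal q.1, s q = Localization.mk a ⟨f, hf⟩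
      res := fun i _ ⟨a, f, h⟩ => ⟨a, f, fun q => h (i q)⟩ }

/-- The monoid `𝒪(U)`. -/
def sections (U : Opens (specTop A)) :
    Submonoid (∀ p : U, Localization (PrimeIdeal.primeCompl p.1)) where
  carrier := {s | (isLocallyFraction A).pred s}
  one_mem' x := ⟨U, x.2, 𝟙 _, 1, 1, fun q => ⟨PrimeIdeal.one_notMem q.1, Localization.mk_one.symm⟩⟩
  mul_mem' {s t} hs ht x := by
    obtain ⟨V, hxV, i, a, f, hV⟩ := hs x
    obtain ⟨W, hxW, j, b, g, hW⟩ := ht x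
    refine ⟨V ⊓ W, ⟨hxV, hxW⟩, Opens.infLELeft _ _ ≫ i, a * b, f * g, fun q => ?_⟩
    obtain ⟨hf, hs'⟩ := hV ⟨q.1, q.2.1⟩
    obtain ⟨hg, ht'⟩ := hW ⟨q.1, q.2.2⟩
    exact ⟨(PrimeIdeal.primeCompl q.1).mul_mem hf hg,
      (congrArg₂ (· * ·) hs' ht').trans (Localization.mk_mul ..)⟩

variable {A} in
/-- Restriction of sections. -/
def restrictHom {U V : Opens (specTop A)} (h : V ≤ U) : sections A U →* sections A V where
  toFun s := ⟨fun p => s.1 ⟨p.1, h p.2⟩, (isLocallyFraction A).res (homOfLE h) s.1 s.2⟩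
  map_one' := rfl
  map_mul' _ _ := rfl

/-- The structure presheaf of `Spec A`. -/
def structurePresheaf : TopCat.Presheaf CommMonCat.{u} (specTop A) where
  obj U := CommMonCat.of (sections A U.unop)
  map i := CommMonCat.ofHom (restrictHom i.unop.le)

theorem structurePresheaf_isSheaf : (structurePresheaf A).IsSheaf :=
  (TopCat.Presheaf.isSheaf_iff_isSheaf_comp (CategoryTheory.forget CommMonCat) _).mpr
    (TopCat.Presheaf.isSheaf_of_iso
      (NatIso.ofComponents (fun _ => Iso.refl _) fun _ => rfl :
        (TopCat.subsheafToTypes (isLocallyFraction A)).1 ≅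
          structurePresheaf A ⋙ CategoryTheory.forget CommMonCat)
      (TopCat.subsheafToTypes (isLocallyFraction A)).2)

end StructureSheaf

/-! ### Monoidal spaces and schemes over `𝔽₁` -/

/-- A monoidal space: a topological space with a sheaf of commutative monoids. Morphisms are pairs
of a continuous map `f : X → Y` and a morphism of sheaves `𝒪_Y → f_* 𝒪_X`. -/
abbrev MonoidalSpace : Type (u + 1) := SheafedSpace.{u + 1, u, u} CommMonCat.{u}

/-- The monoidal space `Spec 𝔽_A = (Spec A, 𝒪)`. -/
def spec (A : CommMonCat.{u}) : MonoidalSpace.{u} where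
  carrier := specTop A
  presheaf := structurePresheaf A
  IsSheaf := structurePresheaf_isSheaf A

/-- The germ at `x` of the section `s` over a neighbourhood of `x` is invertible in the stalk, i.e.
`s` restricts to an invertible section on some neighbourhood of `x`. -/
def IsUnitGerm {X : MonoidalSpace.{u}} {U : Opens X} (s : X.presheaf.obj (op U)) (x : X) : Prop :=
  ∃ (V : Opens X) (h : V ≤ U), x ∈ V ∧ IsUnit (X.presheaf.map (homOfLE h).op s)

/-- A morphism of monoidal spaces is local if for every `x` the map of stalks
`f_x^# : 𝒪_{Y, f(x)} → 𝒪_{X, x}` satisfies `(f_x^#)⁻¹(𝒪_{X, x}ˣ) = 𝒪_{Y, f(x)}ˣ`. -/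
def IsLocalMorphism {X Y : MonoidalSpace.{u}} (f : X ⟶ Y) : Prop :=
  ∀ (x : X) (U : Opens Y) (_ : f.hom.base x ∈ U) (s : Y.presheaf.obj (op U)),
    IsUnitGerm (X := X) (U := (Opens.map f.hom.base).obj U) (f.hom.c.app (op U) s) x ↔
      IsUnitGerm s (f.hom.base x)

/-- An affine scheme over `𝔽₁`. -/
def IsAffine (X : MonoidalSpace.{u}) : Prop := ∃ A : CommMonCat.{u}, Nonempty (X ≅ spec A)

/-- An open subset `U ⊆ X` is affine if `(U, 𝒪_X|_U)` is an affine scheme over `𝔽₁`. -/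
def IsAffineOpen {X : MonoidalSpace.{u}} (U : Opens X) : Prop :=
  IsAffine (X.restrict U.isOpenEmbedding)

/-- A scheme over `𝔽₁`: a monoidal space that is locally affine. -/
structure Scheme where
  toMonoidalSpace : MonoidalSpace.{u}
  exists_isAffineOpen : ∀ x : toMonoidalSpace, ∃ U : Opens toMonoidalSpace, x ∈ U ∧ IsAffineOpen U

/-- The set `X(𝔽_A) = Hom(Spec 𝔽_A, X)` of `𝔽_A`-valued points of `X`: the morphisms of
schemes over `𝔽₁`, i.e. the local morphisms of monoidal spaces. -/
def Scheme.Points (X : Scheme.{u}) (A : CommMonCat.{u}) : Type u :=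
  {f : spec A ⟶ X.toMonoidalSpace // IsLocalMorphism f}

/-! ### Localizations of spectra -/

section Away

open PrimeIdeal

variable {A B : Type u} [CommMonoid A] [CommMonoid B]

/-- The map `A_𝔭 → B_𝔮` induced by `φ : A → B` for prime ideals with `𝔭 ⊇ φ⁻¹(𝔮)`. -/
def localMap (φ : A →* B) (p : PrimeIdeal A) (q : PrimeIdeal B)
    (h : ∀ y : p.primeCompl, φ y ∈ q.primeCompl) :
    Localization p.primeCompl →* Localization q.primeCompl :=
  (Localization.monoidOf p.primeCompl).map h (Localization.monoidOf q.primeCompl)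

theorem localMap_mk (φ : A →* B) (p : PrimeIdeal A) (q : PrimeIdeal B)
    (h : ∀ y : p.primeCompl, φ y ∈ q.primeCompl) (a : A) (s : p.primeCompl) :
    localMap φ p q h (Localization.mk a s) = Localization.mk (φ a) ⟨φ s, h s⟩ := by
  simp only [localMap, Localization.mk_eq_monoidOf_mk'_apply]
  exact Submonoid.LocalizationMap.map_mk' ..

theorem comap_compl (φ : A →* B) (q : PrimeIdeal B) (y : (comap φ q).primeCompl) :
    φ y ∈ q.primeCompl := fun h => y.2 (mem_comap.mpr h)

/-- The morphism `Spec B → Spec A` induced by `φ : A → B`. -/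
def specMap (φ : A →* B) : spec (CommMonCat.of B) ⟶ spec (CommMonCat.of A) :=
  InducedCategory.homMk
    { base := TopCat.ofHom ⟨comap φ, continuous_comap φ⟩
      c :=
        { app := fun U => CommMonCat.ofHom
            { toFun := fun (s : sections A U.unop) =>
                (⟨fun q => localMap φ (comap φ q.1) q.1 (comap_compl φ q.1) (s.1 ⟨_, q.2⟩),
                  fun q => by
                    obtain ⟨V, hqV, i, a, f, hV⟩ := s.2 ⟨_, q.2⟩
                    refine ⟨(Opens.map (TopCat.ofHom ⟨comap φ, continuous_comap φ⟩)).obj V, hqV,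
                      homOfLE fun x hx => i.le hx, φ a, φ f, fun r => ?_⟩
                    obtain ⟨hf, h⟩ := hV ⟨_, r.2⟩
                    refine ⟨fun hf' => hf (mem_comap.mpr hf'), ?_⟩
                    refine (congrArg _ h).trans (localMap_mk ..)⟩ :
                  sections B ((Opens.map
                    (TopCat.ofHom ⟨comap φ, continuous_comap φ⟩ : specTop B ⟶ specTop A)).obj
                      U.unop))
              map_one' := Subtype.ext (funext fun _ => map_one _)
              map_mul' := fun _ _ => Subtype.ext (funext fun _ => map_mul _ _ _) }
          naturality := fun _ _ _ => rfl } }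


theorem isUnit_map_of_isLocalizationMap {f : A} {φ : A →* B}
    (hφ : (Submonoid.powers f).IsLocalizationMap φ) : IsUnit (φ f) :=
  hφ.map_units ⟨f, Submonoid.mem_powers f⟩

theorem notMem_of_isUnit (q : PrimeIdeal B) {b : B} (hb : IsUnit b) : b ∉ q.asIdeal := fun h => by
  obtain ⟨c, hc⟩ := hb.exists_right_inv
  exact q.one_notMem (hc ▸ q.mul_mem_right c h)

theorem mem_mul_unit (q : PrimeIdeal B) {b c : B} (hc : IsUnit c) :
    b * c ∈ q.asIdeal ↔ b ∈ q.asIdeal :=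
  ⟨fun h => (q.mem_or_mem h).resolve_right (notMem_of_isUnit q hc), q.mul_mem_right c⟩

theorem comap_injective {f : A} {φ : A →* B}
    (hφ : (Submonoid.powers f).IsLocalizationMap φ) : Function.Injective (comap φ) := by
  intro q q' h
  refine PrimeIdeal.ext (SetLike.ext fun b => ?_)
  obtain ⟨⟨a, s⟩, ha⟩ := hφ.surj b
  rw [← mem_mul_unit q (hφ.map_units s), ← mem_mul_unit q' (hφ.map_units s), ha, ← mem_comap,
    ← mem_comap, h]

theorem range_comap {f : A} {φ : A →* B}
    (hφ : (Submonoid.powers f).IsLocalizationMap φ) : Set.range (comap φ) = basicOpen f := by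
  ext p
  constructor
  · rintro ⟨q, rfl⟩ h
    exact notMem_of_isUnit q (isUnit_map_of_isLocalizationMap hφ) (mem_comap.mp h)
  · intro hp
    have hp' : f ∉ p.asIdeal := hp
    refine ⟨ofCompl
      { carrier := {b | ∃ c, ∃ a ∉ p.asIdeal, b * c = φ a}
        one_mem' := ⟨1, 1, p.one_notMem, by simp⟩
        mul_mem' := ?_ } ?_, ?_⟩
    · rintro b b' ⟨c, a, ha, h⟩ ⟨c', a', ha', h'⟩
      exact ⟨c * c', a * a', p.primeCompl.mul_mem ha ha', by
        rw [map_mul, ← h, ← h', mul_mul_mul_comm]⟩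
    · rintro b b' ⟨c, a, ha, h⟩
      exact ⟨b * c, a, ha, by rw [← h]; ac_rfl⟩
    · refine PrimeIdeal.ext (SetLike.ext fun x => ?_)
      rw [mem_comap, mem_ofCompl, not_iff_comm]
      constructor
      · exact fun hx => ⟨1, x, hx, by simp⟩
      · rintro ⟨c, a, ha, h⟩
        obtain ⟨⟨c', s⟩, hc'⟩ := hφ.surj c
        have : φ (x * c') = φ (a * s) := by rw [map_mul, map_mul, ← hc', ← h, mul_assoc]
        obtain ⟨t, ht⟩ := hφ.exists_of_eq this
        have hpow : ∀ s : Submonoid.powers f, (s : A) ∉ p.asIdeal := by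
          rintro ⟨_, n, rfl⟩
          exact p.pow_notMem hp' n
        have hmem : (t : A) * (a * s) ∉ p.asIdeal :=
          p.primeCompl.mul_mem (hpow t) (p.primeCompl.mul_mem ha (hpow s))
        rw [← ht] at hmem
        exact fun hx => hmem (p.mul_mem_left _ (p.mul_mem_right _ hx))

theorem isOpenMap_comap {f : A} {φ : A →* B}
    (hφ : (Submonoid.powers f).IsLocalizationMap φ) : IsOpenMap (comap φ) := by
  intro U hU
  rw [isOpen_iff_forall_mem_open]
  rintro _ ⟨q, hq, rfl⟩
  obtain ⟨b, hqb, hbU⟩ := exists_basicOpen (U := ⟨U, hU⟩) hq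
  obtain ⟨⟨a, s⟩, ha⟩ := hφ.surj b
  have key : ∀ r : PrimeIdeal B, b ∈ r.asIdeal ↔ a ∈ (comap φ r).asIdeal := fun r => by
    rw [mem_comap, ← mem_mul_unit r (hφ.map_units s), ha]
  refine ⟨basicOpen a ⊓ basicOpen f, ?_, (basicOpen a ⊓ basicOpen f).isOpen,
    fun h => hqb ((key q).mpr h), ?_⟩
  · rintro p ⟨hpa, hpf⟩
    rw [← range_comap hφ] at hpf
    obtain ⟨r, rfl⟩ := hpf
    exact ⟨r, hbU fun h => hpa ((key r).mp h), rfl⟩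
  · rw [← range_comap hφ]
    exact ⟨q, rfl⟩

theorem isOpenEmbedding_comap {f : A} {φ : A →* B}
    (hφ : (Submonoid.powers f).IsLocalizationMap φ) : Topology.IsOpenEmbedding (comap φ) :=
  .of_continuous_injective_isOpenMap (continuous_comap φ) (comap_injective hφ) (isOpenMap_comap hφ)

theorem localMap_injective {f : A} {φ : A →* B}
    (hφ : (Submonoid.powers f).IsLocalizationMap φ) (q : PrimeIdeal B) :
    Function.Injective (localMap φ (comap φ q) q (comap_compl φ q)) := by
  have hpow : ∀ s : Submonoid.powers f, (s : A) ∉ (comap φ q).asIdeal := fun s h =>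
    notMem_of_isUnit q (hφ.map_units s) (mem_comap.mp h)
  intro x y h
  induction x using Localization.induction_on with | _ x
  induction y using Localization.induction_on with | _ y
  rw [localMap_mk, localMap_mk, Localization.mk_eq_mk_iff, Localization.r_iff_exists] at h
  obtain ⟨⟨c, hc⟩, h⟩ := h
  obtain ⟨⟨a, s⟩, ha⟩ := hφ.surj c
  have ha' : a ∉ (comap φ q).asIdeal := by
    rw [mem_comap, ← ha]
    exact q.primeCompl.mul_mem hc (notMem_of_isUnit q (hφ.map_units s))
  have : φ (a * (y.2 * x.1)) = φ (a * (x.2 * y.1)) := by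
    simp only [map_mul] at h ⊢
    rw [← ha, mul_right_comm, h, mul_right_comm]
  obtain ⟨t, ht⟩ := hφ.exists_of_eq this
  rw [Localization.mk_eq_mk_iff, Localization.r_iff_exists]
  exact ⟨⟨t * a, (comap φ q).primeCompl.mul_mem (hpow t) ha'⟩, by
    simpa only [mul_assoc] using ht⟩

theorem isOpenEmbedding_specMap {f : A} {φ : A →* B}
    (hφ : (Submonoid.powers f).IsLocalizationMap φ) :
    Topology.IsOpenEmbedding (specMap φ).hom.base := isOpenEmbedding_comap hφ

/-- Fractions in `B_𝔮` are fractions of elements of `A`. -/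
theorem exists_fraction {f : A} {φ : A →* B}
    (hφ : (Submonoid.powers f).IsLocalizationMap φ) (b g : B) :
    ∃ a h : A, ∀ (q : PrimeIdeal B) (hg : g ∉ q.asIdeal), ∃ hh : h ∉ (comap φ q).asIdeal,
      localMap φ (comap φ q) q (comap_compl φ q) (Localization.mk a ⟨h, hh⟩) =
        Localization.mk b ⟨g, hg⟩ := by
  obtain ⟨⟨a, s⟩, ha⟩ := hφ.surj b
  obtain ⟨⟨h, t⟩, hh⟩ := hφ.surj g
  dsimp only at ha hh
  refine ⟨a * t, h * s, fun q hg => ⟨fun hm => ?_, ?_⟩⟩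
  · rw [mem_comap, map_mul, ← hh] at hm
    rw [mem_mul_unit q (hφ.map_units s), mem_mul_unit q (hφ.map_units t)] at hm
    exact hg hm
  · rw [localMap_mk, Localization.mk_eq_mk_iff, Localization.r_iff_exists]
    refine ⟨1, ?_⟩
    simp only [map_mul, OneMemClass.coe_one, one_mul]
    rw [← hh, ← ha]
    ac_rfl

theorem exists_section {f : A} {φ : A →* B} (hφ : (Submonoid.powers f).IsLocalizationMap φ)
    {U : Opens (specTop B)} {W : Opens (specTop A)} (hW : W.1 = comap φ '' U.1)
    (t : sections B U) :
    ∃ s : sections A W, ∀ (q : PrimeIdeal B) (hq : q ∈ U) (hq' : comap φ q ∈ W),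
      localMap φ (comap φ q) q (comap_compl φ q) (s.1 ⟨_, hq'⟩) = t.1 ⟨q, hq⟩ := by
  have hmem : ∀ p : PrimeIdeal A, p ∈ W → ∃ q ∈ U, comap φ q = p := fun p hp => hW.le hp
  have key : ∀ p : PrimeIdeal A, p ∈ W → ∃ z : Localization p.primeCompl,
      ∀ (q : PrimeIdeal B) (hq : q ∈ U) (h : comap φ q = p),
        localMap φ p q (fun y => comap_compl φ q ⟨y, h ▸ y.2⟩) z = t.1 ⟨q, hq⟩ := by
    intro p hp
    obtain ⟨q, hq, rfl⟩ := hmem p hp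
    obtain ⟨V, hqV, i, b, g, hV⟩ := t.2 ⟨q, hq⟩
    obtain ⟨hg, h⟩ := hV ⟨q, hqV⟩
    obtain ⟨a, h', hh⟩ := exists_fraction hφ b g
    obtain ⟨hh', e⟩ := hh q hg
    refine ⟨Localization.mk a ⟨h', hh'⟩, fun r hr hrq => ?_⟩
    obtain rfl := comap_injective hφ hrq
    exact e.trans h.symm
  choose z hz using key
  refine ⟨⟨fun p => z p.1 p.2, ?_⟩, fun q hq hq' => hz _ hq' q hq rfl⟩
  intro p
  obtain ⟨q, hq, hqp⟩ := hmem p.1 p.2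
  obtain ⟨V, hqV, i, b, g, hV⟩ := t.2 ⟨q, hq⟩
  obtain ⟨a, h', hh⟩ := exists_fraction hφ b g
  refine ⟨⟨comap φ '' V.1, isOpenMap_comap hφ _ V.isOpen⟩, ⟨q, hqV, hqp⟩,
    homOfLE fun p hp => hW.ge (Set.image_mono (fun x hx => i.le hx) hp), a, h', fun r => ?_⟩
  obtain ⟨_, r, hr, rfl⟩ := r
  obtain ⟨hg, h⟩ := hV ⟨r, hr⟩
  obtain ⟨hh', e⟩ := hh r hg
  exact ⟨hh', localMap_injective hφ r ((hz _ _ r (i.le hr) rfl).trans (h.trans e.symm))⟩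

theorem isOpenImmersion_specMap {f : A} {φ : A →* B}
    (hφ : (Submonoid.powers f).IsLocalizationMap φ) :
    SheafedSpace.IsOpenImmersion (specMap φ) where
  base_open := isOpenEmbedding_specMap hφ
  c_iso U := by
    rw [ConcreteCategory.isIso_iff_bijective]
    constructor
    · intro s t hst
      refine Subtype.ext (funext ?_)
      rintro ⟨_, q, hq, rfl⟩
      refine localMap_injective hφ q ?_
      exact congrFun (congrArg Subtype.val hst) ⟨q, ⟨q, hq, rfl⟩⟩
    · intro t
      obtain ⟨s, hs⟩ := exists_section hφ (U := (Opens.map (specMap φ).hom.base).obj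
        ((isOpenEmbedding_specMap hφ).functor.obj U))
        (W := (isOpenEmbedding_specMap hφ).functor.obj U)
        (Set.image_preimage_eq_of_subset (Set.image_subset_range _ _)).symm t
      exact ⟨s, Subtype.ext (funext fun q => hs q.1 q.2 q.2)⟩

/-- Sections over `D(f)` are fractions `a / f ^ n`. -/
theorem exists_section_eq {f : A} {U : Opens (specTop A)} (hU : U = basicOpen f)
    (s : sections A U) :
    ∃ (a : A) (n : ℕ), ∀ q : U, s.1 q = Localization.mk a
      ⟨f ^ n, PrimeIdeal.pow_notMem q.1 (hU.le q.2) n⟩ := by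
  subst hU
  obtain ⟨V, hfV, i, a, g, hV⟩ := s.2 ⟨_, maxAway_mem f⟩
  obtain ⟨n, c, hc⟩ := notMem_maxAway.mp (hV ⟨_, hfV⟩).1
  refine ⟨a * c, n, fun q => ?_⟩
  obtain ⟨hg, h⟩ := hV ⟨q.1, basicOpen_le hfV q.2⟩
  refine h.trans ?_
  rw [Localization.mk_eq_mk_iff, Localization.r_iff_exists]
  refine ⟨1, ?_⟩
  simp only [OneMemClass.coe_one, one_mul]
  rw [hc]
  ac_rfl

/-- The section `𝔭 ↦ a / 1`. -/
def toSection (U : Opens (specTop A)) (a : A) : sections A U :=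
  ⟨fun _ => Localization.mk a 1, fun q => ⟨U, q.2, 𝟙 _, a, 1, fun r =>
    ⟨PrimeIdeal.one_notMem r.1, rfl⟩⟩⟩

theorem isLocalizationMap_sections (f : A) :
    (Submonoid.powers (toSection ⊤ f)).IsLocalizationMap
      (restrictHom (le_top : (basicOpen f : Opens (specTop A)) ≤ ⊤)) := by
  have hpow : ∀ n : ℕ, toSection ⊤ (f ^ n) = toSection ⊤ f ^ n := fun n => by
    refine Subtype.ext (funext fun q => ?_)
    change Localization.mk (f ^ n) 1 = (Localization.mk f 1) ^ n
    rw [Localization.mk_pow, one_pow]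
  have htop : (⊤ : Opens (specTop A)) = basicOpen (1 : A) :=
    le_antisymm (fun (q : PrimeIdeal A) _ => PrimeIdeal.one_notMem q) le_top
  have hglob : ∀ s : sections A ⊤, ∃ a, s = toSection ⊤ a := fun s => by
    obtain ⟨a, n, h⟩ := exists_section_eq htop s
    refine ⟨a, Subtype.ext (funext fun q => (h q).trans ?_)⟩
    congr 1
    exact Subtype.ext (one_pow n)
  constructor
  · rintro ⟨_, n, rfl⟩
    have : IsUnit (restrictHom (le_top : (basicOpen f : Opens (specTop A)) ≤ ⊤)
        (toSection ⊤ f)) := by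
      refine IsUnit.of_mul_eq_one
        ⟨fun q => Localization.mk 1 ⟨f, q.2⟩, fun q => ⟨basicOpen f, q.2, 𝟙 _, 1, f, fun r =>
          ⟨r.2, rfl⟩⟩⟩ (Subtype.ext (funext fun q => ?_))
      change Localization.mk f 1 * Localization.mk 1 ⟨f, q.2⟩ = 1
      rw [Localization.mk_mul, ← Localization.mk_one, Localization.mk_eq_mk_iff,
        Localization.r_iff_exists]
      exact ⟨1, by simp⟩
    exact map_pow (restrictHom _) (toSection ⊤ f) n ▸ this.pow n
  · intro (s : sections A (basicOpen f))
    obtain ⟨a, n, h⟩ := exists_section_eq rfl s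
    refine ⟨⟨toSection ⊤ a, ⟨toSection ⊤ (f ^ n), n, (hpow n).symm⟩⟩, ?_⟩
    refine Subtype.ext (funext fun q => ?_)
    change s.1 q * Localization.mk (f ^ n) 1 = Localization.mk a 1
    rw [h q, Localization.mk_mul, Localization.mk_eq_mk_iff, Localization.r_iff_exists]
    exact ⟨1, by simp [mul_comm]⟩
  · intro (s : sections A ⊤) (t : sections A ⊤) hst
    obtain ⟨a, rfl⟩ := hglob s
    obtain ⟨b, rfl⟩ := hglob t
    have : Localization.mk a (1 : (maxAway f).primeCompl) = Localization.mk b 1 :=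
      congrFun (congrArg Subtype.val hst) ⟨_, maxAway_mem f⟩
    rw [Localization.mk_eq_mk_iff, Localization.r_iff_exists] at this
    obtain ⟨⟨c, hc⟩, h⟩ := this
    obtain ⟨n, d, hd⟩ := notMem_maxAway.mp hc
    refine ⟨⟨toSection ⊤ (f ^ n), n, (hpow n).symm⟩, Subtype.ext (funext fun q => ?_)⟩
    change Localization.mk (f ^ n) 1 * Localization.mk a 1 =
      Localization.mk (f ^ n) 1 * Localization.mk b 1
    rw [Localization.mk_mul, Localization.mk_mul, hd]
    simp only [OneMemClass.coe_one, one_mul] at h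
    rw [mul_right_comm, h, mul_right_comm]

end Away

/-! ### Affine open subsets of a monoidal space -/

section AffineOpen

open PrimeIdeal

variable {X : MonoidalSpace.{u}}

/-- The restriction map `𝒪(U) → 𝒪(V)`. -/
def res {U V : Opens X} (h : V ≤ U) : X.presheaf.obj (op U) →* X.presheaf.obj (op V) :=
  (X.presheaf.map (homOfLE h).op).hom

/-- `U` is the image of the open immersion `j : Spec A → X`. -/
structure IsChart (U : Opens X) (A : CommMonCat.{u}) (j : spec A ⟶ X) : Prop where
  isOpenImmersion : SheafedSpace.IsOpenImmersion j
  range_eq : Set.range j.hom.base = U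

theorem IsAffineOpen.exists_chart {U : Opens X} (hU : IsAffineOpen U) :
    ∃ (A : CommMonCat.{u}) (j : spec A ⟶ X), IsChart U A j := by
  obtain ⟨A, ⟨e⟩⟩ := hU
  have : PresheafedSpace.IsOpenImmersion (X.ofRestrict U.isOpenEmbedding).hom :=
    PresheafedSpace.IsOpenImmersion.ofRestrict _ _
  have : PresheafedSpace.IsOpenImmersion e.inv.hom :=
    PresheafedSpace.IsOpenImmersion.ofIsIso _
  refine ⟨A, e.inv ≫ X.ofRestrict U.isOpenEmbedding,
    PresheafedSpace.IsOpenImmersion.comp e.inv.hom (X.ofRestrict U.isOpenEmbedding).hom, ?_⟩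
  ext x
  constructor
  · rintro ⟨y, rfl⟩
    exact (e.inv.hom.base y).2
  · intro hx
    refine ⟨e.hom.hom.base ⟨x, hx⟩, ?_⟩
    have : e.inv.hom.base (e.hom.hom.base ⟨x, hx⟩) = ⟨x, hx⟩ :=
      congr(($(e.hom_inv_id)).hom.base ⟨x, hx⟩)
    exact congrArg Subtype.val this

theorem IsChart.isAffineOpen {U : Opens X} {A : CommMonCat.{u}} {j : spec A ⟶ X}
    (h : IsChart U A j) : IsAffineOpen U := by
  have := h.isOpenImmersion
  have : PresheafedSpace.IsOpenImmersion (X.ofRestrict U.isOpenEmbedding).hom :=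
    PresheafedSpace.IsOpenImmersion.ofRestrict _ _
  refine ⟨A, ⟨SheafedSpace.isoMk (PresheafedSpace.IsOpenImmersion.isoOfRangeEq
    (X.ofRestrict U.isOpenEmbedding).hom j.hom ?_)⟩⟩
  rw [h.range_eq]
  exact Subtype.range_coe

theorem isLocalizationMap_conj {M N M' N' : Type u} [CommMonoid M] [CommMonoid N] [CommMonoid M']
    [CommMonoid N'] {r : M →* N} {r' : M' →* N'} (e₁ : M →* M') (e₂ : N →* N')
    (h₁ : Function.Bijective e₁) (h₂ : Function.Bijective e₂) (h : ∀ x, r' (e₁ x) = e₂ (r x))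
    {x : M} (hr : (Submonoid.powers x).IsLocalizationMap r) :
    (Submonoid.powers (e₁ x)).IsLocalizationMap r' := by
  have hpow : ∀ s : Submonoid.powers x, e₁ s ∈ Submonoid.powers (e₁ x) := by
    rintro ⟨_, n, rfl⟩
    exact ⟨n, (map_pow ..).symm⟩
  constructor
  · rintro ⟨_, n, rfl⟩
    change IsUnit (r' (e₁ x ^ n))
    rw [← map_pow, h]
    exact (hr.map_units ⟨_, n, rfl⟩).map e₂
  · intro z
    obtain ⟨z, rfl⟩ := h₂.2 z
    obtain ⟨⟨a, s⟩, ha⟩ := hr.surj z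
    exact ⟨⟨e₁ a, ⟨e₁ s, hpow s⟩⟩, by rw [h, h, ← map_mul, ha]⟩
  · intro a b hab
    obtain ⟨a, rfl⟩ := h₁.2 a
    obtain ⟨b, rfl⟩ := h₁.2 b
    rw [h, h] at hab
    obtain ⟨c, hc⟩ := hr.exists_of_eq (h₂.1 hab)
    exact ⟨⟨e₁ c, hpow c⟩, by simp only [← map_mul, hc]⟩

theorem res_res {U V W : Opens X} (h : V ≤ U) (h' : W ≤ V) (s : X.presheaf.obj (op U)) :
    res h' (res h s) = res (h'.trans h) s :=
  congr($(X.presheaf.map_comp (homOfLE h).op (homOfLE h').op) s).symm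

theorem res_bijective {U V : Opens X} (h : U = V) :
    Function.Bijective (res (X := X) h.ge) := by
  subst h
  have : ⇑(res (X := X) (le_refl U)) = id :=
    funext fun s => congr($(X.presheaf.map_id (op U)) s)
  rw [this]
  exact Function.bijective_id

namespace IsChart

variable {U V : Opens X} {A : CommMonCat.{u}} {j : spec A ⟶ X}

/-- The open subset of `X` corresponding to an open subset of `Spec A`. -/
def image (h : IsChart U A j) (O : Opens (specTop A)) : Opens X :=
  h.isOpenImmersion.base_open.isOpenMap.functor.obj O

theorem image_top (h : IsChart U A j) : h.image ⊤ = U :=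
  Opens.ext (Set.image_univ.trans h.range_eq)

/-- The identification `𝒪_{Spec A}(O) ≅ 𝒪_X(j(O))`. -/
def imageIso (h : IsChart U A j) (O : Opens (specTop A)) :
    sections A O →* X.presheaf.obj (op (h.image O)) :=
  (@PresheafedSpace.IsOpenImmersion.invApp _ _ _ _ j.hom h.isOpenImmersion O).hom

theorem imageIso_bijective (h : IsChart U A j) (O : Opens (specTop A)) :
    Function.Bijective (h.imageIso O) := by
  have := h.isOpenImmersion
  have : IsIso (PresheafedSpace.IsOpenImmersion.invApp j.hom O) :=
    PresheafedSpace.IsOpenImmersion.instIsIsoInvApp j.hom O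
  exact (ConcreteCategory.isIso_iff_bijective _).mp this

theorem imageIso_res (h : IsChart U A j) {O O' : Opens (specTop A)} (hO : O' ≤ O)
    (hi : h.image O' ≤ h.image O) (s : sections A O) :
    res hi (h.imageIso O s) = h.imageIso O' (restrictHom hO s) := by
  have := h.isOpenImmersion
  have e := PresheafedSpace.IsOpenImmersion.inv_naturality j.hom
    (U := op O) (V := op O') (homOfLE hO).op
  exact congr($(e.symm) s)

/-- `f ∈ A` as an element of `𝒪_X(U)`. -/
def toSection (h : IsChart U A j) (f : A) : X.presheaf.obj (op U) :=
  res h.image_top.ge (h.imageIso ⊤ (FOne.toSection ⊤ f))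

theorem toSection_mul (h : IsChart U A j) (f g : A) :
    h.toSection (f * g) = h.toSection f * h.toSection g := by
  have : FOne.toSection (A := A) ⊤ (f * g) = FOne.toSection ⊤ f * FOne.toSection ⊤ g :=
    Subtype.ext (funext fun _ => by
      refine Eq.trans ?_ (Localization.mk_mul ..).symm
      rw [one_mul]; rfl)
  rw [toSection, this, map_mul, map_mul]; rfl

theorem isLocalizationMap_res (h : IsChart U A j) (f : A) (hV : V = h.image (basicOpen f))
    (hVU : V ≤ U) : (Submonoid.powers (h.toSection f)).IsLocalizationMap (res hVU) := by
  subst hV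
  refine isLocalizationMap_conj ((res h.image_top.ge).comp (h.imageIso ⊤)) (h.imageIso _)
    ((res_bijective h.image_top).comp (h.imageIso_bijective _)) (h.imageIso_bijective _)
    (fun s => ?_) (isLocalizationMap_sections f)
  refine (res_res _ _ _).trans ?_
  exact h.imageIso_res _ _ s

theorem isAffineOpen_basicOpen (h : IsChart U A j) (f : A) :
    IsAffineOpen (h.image (basicOpen f)) := by
  have h₀ := h.isOpenImmersion
  let φ : A →* Localization (Submonoid.powers f) :=
    (Localization.monoidOf (Submonoid.powers f)).toMonoidHom
  have hφ : (Submonoid.powers f).IsLocalizationMap φ :=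
    (Localization.monoidOf (Submonoid.powers f)).isLocalizationMap
  have h₁ : PresheafedSpace.IsOpenImmersion (specMap φ).hom := isOpenImmersion_specMap hφ
  refine IsChart.isAffineOpen (A := CommMonCat.of (Localization (Submonoid.powers f)))
    (j := specMap φ ≫ j) ⟨PresheafedSpace.IsOpenImmersion.comp (specMap φ).hom j.hom, ?_⟩
  refine (Set.range_comp j.hom.base (comap φ)).trans ?_
  exact congrArg (Set.image j.hom.base) (range_comap hφ)

/-- The closed point `A ∖ Aˣ` lies in no proper open subset. -/
theorem eq_top_of_mem {A : Type u} [CommMonoid A] {O : Opens (specTop A)}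
    (hO : maxAway (1 : A) ∈ O) : O = ⊤ :=
  top_le_iff.mp fun q _ => basicOpen_le hO (PrimeIdeal.one_notMem q)

theorem exists_basicOpen (h : IsChart U A j) (hV : IsAffineOpen V) (hVU : V ≤ U) :
    ∃ f : A, V = h.image (basicOpen f) := by
  obtain ⟨B, k, hk⟩ := hV.exists_chart
  have hmin : ∀ N : Opens X, k.hom.base (maxAway (1 : B)) ∈ N → V ≤ N := fun N hN => by
    have := eq_top_of_mem (O := (Opens.map k.hom.base).obj N) hN
    intro x hx
    obtain ⟨y, rfl⟩ := hk.range_eq.ge hx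
    exact (this.ge trivial : y ∈ (Opens.map k.hom.base).obj N)
  have hv : k.hom.base (maxAway (1 : B)) ∈ V := hk.range_eq.le ⟨_, rfl⟩
  obtain ⟨p, hp⟩ := h.range_eq.ge (hVU hv)
  obtain ⟨f, hpf, hf⟩ := PrimeIdeal.exists_basicOpen (A := A)
    (U := (Opens.map j.hom.base).obj V) (p := p) (by change j.hom.base p ∈ V; rw [hp]; exact hv)
  refine ⟨f, le_antisymm (hmin _ ⟨p, hpf, hp⟩) ?_⟩
  rintro _ ⟨q, hq, rfl⟩
  exact hf hq

end IsChart

/-- The inclusion of affine open subsets `V ⊆ U` is a localization `𝒪(U) → 𝒪(V) = 𝒪(U)_f`. -/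
theorem IsAffineOpen.exists_isLocalizationMap {U V : Opens X} (hU : IsAffineOpen U)
    (hV : IsAffineOpen V) (h : V ≤ U) :
    ∃ f : X.presheaf.obj (op U), (Submonoid.powers f).IsLocalizationMap (res h) := by
  obtain ⟨A, j, hj⟩ := hU.exists_chart
  obtain ⟨f, hf⟩ := hj.exists_basicOpen hV h
  exact ⟨_, hj.isLocalizationMap_res f hf h⟩

/-- The intersection of affine open subsets `V, V' ⊆ U` is affine. -/
theorem IsAffineOpen.inter {U V V' : Opens X} (hU : IsAffineOpen U) (hV : IsAffineOpen V)
    (hV' : IsAffineOpen V') (h : V ≤ U) (h' : V' ≤ U) :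
    IsAffineOpen (V ⊓ V') ∧ ∃ f f' : X.presheaf.obj (op U),
      (Submonoid.powers f).IsLocalizationMap (res h) ∧
      (Submonoid.powers f').IsLocalizationMap (res h') ∧
      (Submonoid.powers (f * f')).IsLocalizationMap (res (inf_le_left.trans h : V ⊓ V' ≤ U)) := by
  obtain ⟨A, j, hj⟩ := hU.exists_chart
  obtain ⟨f, hf⟩ := hj.exists_basicOpen hV h
  obtain ⟨f', hf'⟩ := hj.exists_basicOpen hV' h'
  have e : V ⊓ V' = hj.image (basicOpen (f * f')) := by
    have : (basicOpen (f * f') : Opens (PrimeIdeal A)) = basicOpen f ⊓ basicOpen f' := by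
      ext p
      constructor
      · exact fun hp => ⟨fun hf => hp (p.mul_mem_right _ hf), fun hf => hp (p.mul_mem_left _ hf)⟩
      · rintro ⟨hp, hp'⟩ hm
        exact (p.mem_or_mem hm).elim hp hp'
    rw [hf, hf', this]
    refine Opens.ext (Set.image_inter ?_).symm
    exact hj.isOpenImmersion.base_open.injective
  refine ⟨e ▸ hj.isAffineOpen_basicOpen _, _, _, hj.isLocalizationMap_res f hf h,
    hj.isLocalizationMap_res f' hf' h', ?_⟩
  rw [← hj.toSection_mul]
  exact hj.isLocalizationMap_res _ e _

end AffineOpen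

/-! ### Base extension to `ℤ` -/

section MonoidRing

open AlgebraicGeometry.Scheme

variable {M N : Type u} [CommMonoid M] [CommMonoid N]

/-- `Spec ℤ[N] → Spec ℤ[M]` for a homomorphism `φ : M → N`. -/
abbrev specIntMap (φ : M →* N) :
    Spec (CommRingCat.of (MonoidAlgebra ℤ N)) ⟶ Spec (CommRingCat.of (MonoidAlgebra ℤ M)) :=
  Spec.map (CommRingCat.ofHom (MonoidAlgebra.mapDomainRingHom ℤ φ))

/-- `ℤ[M_f]` is the localization of `ℤ[M]` at `f`. -/
theorem isLocalization_monoidAlgebra {f : M} {φ : M →* N}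
    (hφ : (Submonoid.powers f).IsLocalizationMap φ) :
    letI := (MonoidAlgebra.mapDomainRingHom ℤ φ).toAlgebra
    IsLocalization.Away (MonoidAlgebra.of ℤ M f) (MonoidAlgebra ℤ N) := by
  let := (MonoidAlgebra.mapDomainRingHom ℤ φ).toAlgebra
  let L := Localization.Away (MonoidAlgebra.of ℤ M f)
  let Φ : (Submonoid.powers f).LocalizationMap N := ⟨φ.toMulHom, hφ⟩
  have hΦ : ∀ m, Φ m = φ m := fun _ => rfl
  let ψ : M →* L := (algebraMap (MonoidAlgebra ℤ M) L : _ →* L).comp (MonoidAlgebra.of ℤ M)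
  have hψ : ∀ y : Submonoid.powers f, IsUnit (ψ y) := by
    rintro ⟨_, n, rfl⟩
    change IsUnit (ψ (f ^ n))
    rw [map_pow]
    exact (IsLocalization.Away.algebraMap_isUnit (S := L) (MonoidAlgebra.of ℤ M f)).pow n
  let g : MonoidAlgebra ℤ N →+* L := (MonoidAlgebra.lift ℤ L N (Φ.lift hψ)).toRingHom
  have hu : IsUnit (algebraMap (MonoidAlgebra ℤ M) (MonoidAlgebra ℤ N)
      (MonoidAlgebra.of ℤ M f)) := by
    have : algebraMap (MonoidAlgebra ℤ M) (MonoidAlgebra ℤ N) (MonoidAlgebra.of ℤ M f) =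
        MonoidAlgebra.of ℤ N (φ f) := by
      simp [RingHom.algebraMap_toAlgebra]
    rw [this]
    exact (isUnit_map_of_isLocalizationMap hφ).map _
  let h : L →+* MonoidAlgebra ℤ N := IsLocalization.Away.lift (MonoidAlgebra.of ℤ M f) hu
  have hh : ∀ a, h (algebraMap _ _ a) = algebraMap (MonoidAlgebra ℤ M) _ a := fun a =>
    IsLocalization.Away.lift_eq _ _ a
  have hg : ∀ a, g (algebraMap _ _ a) = algebraMap (MonoidAlgebra ℤ M) _ a := by
    have : g.comp (algebraMap (MonoidAlgebra ℤ M) (MonoidAlgebra ℤ N)) =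
        algebraMap (MonoidAlgebra ℤ M) L := by
      refine MonoidAlgebra.ringHom_ext' (Subsingleton.elim _ _) (MonoidHom.ext fun m => ?_)
      refine Eq.trans ?_ (Φ.lift_eq hψ m)
      simp [g, RingHom.algebraMap_toAlgebra, hΦ]
      rw [Algebra.smul_def, map_one, one_mul]
    exact fun a => congr($this a)
  have hgh : ∀ x, g (h x) = x := by
    have : g.comp h = RingHom.id L :=
      IsLocalization.ringHom_ext (Submonoid.powers (MonoidAlgebra.of ℤ M f))
        (RingHom.ext fun a => by simp [hh, hg])
    exact fun x => congr($this x)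
  have hhg : ∀ x, h (g x) = x := by
    have : h.comp g = RingHom.id (MonoidAlgebra ℤ N) := by
      refine MonoidAlgebra.ringHom_ext' (Subsingleton.elim _ _)
        (Φ.epic_of_localizationMap (MonoidHom.ext fun m => ?_))
      change h (g (MonoidAlgebra.of ℤ N (φ m))) = MonoidAlgebra.of ℤ N (φ m)
      have e : MonoidAlgebra.of ℤ N (φ m) =
          algebraMap (MonoidAlgebra ℤ M) (MonoidAlgebra ℤ N) (MonoidAlgebra.of ℤ M m) := by
        simp [RingHom.algebraMap_toAlgebra]
      rw [e, hg, hh]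
    exact fun x => congr($this x)
  exact IsLocalization.isLocalization_of_algEquiv (Submonoid.powers (MonoidAlgebra.of ℤ M f))
    (AlgEquiv.ofRingEquiv (f := RingEquiv.ofRingHom h g (RingHom.ext hhg) (RingHom.ext hgh)) hh)

theorem isOpenImmersion_specIntMap {f : M} {φ : M →* N}
    (hφ : (Submonoid.powers f).IsLocalizationMap φ) : IsOpenImmersion (specIntMap φ) := by
  let := (MonoidAlgebra.mapDomainRingHom ℤ φ).toAlgebra
  have := isLocalization_monoidAlgebra hφ
  exact IsOpenImmersion.of_isLocalization (S := MonoidAlgebra ℤ N) (MonoidAlgebra.of ℤ M f)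

theorem range_specIntMap {f : M} {φ : M →* N}
    (hφ : (Submonoid.powers f).IsLocalizationMap φ) :
    Set.range (specIntMap φ) = (PrimeSpectrum.basicOpen (MonoidAlgebra.of ℤ M f)).1 := by
  let := (MonoidAlgebra.mapDomainRingHom ℤ φ).toAlgebra
  have := isLocalization_monoidAlgebra hφ
  exact PrimeSpectrum.localization_away_comap_range (MonoidAlgebra ℤ N) (MonoidAlgebra.of ℤ M f)

end MonoidRing

namespace Scheme

variable (X : Scheme.{u})

/-- The set of affine open subsets of `X`, ordered by inclusion. -/
abbrev AffineOpens : Type u := {U : Opens X.toMonoidalSpace // IsAffineOpen U}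

theorem res_refl {X : MonoidalSpace.{u}} (U : Opens X) (h : U ≤ U) :
    res (X := X) h = MonoidHom.id _ :=
  MonoidHom.ext fun s => congr($(X.presheaf.map_id (op U)) s)

/-- The gluing diagram `U ↦ Spec (𝒪_X(U) ⊗ ℤ) = Spec ℤ[𝒪_X(U)]` on the affine open subsets
`U = Spec 𝒪_X(U)` of `X`. -/
def intDiagram : X.AffineOpens ⥤ AlgebraicGeometry.Scheme.{u} where
  obj U := Spec (CommRingCat.of (MonoidAlgebra ℤ (X.toMonoidalSpace.presheaf.obj (op U.1))))
  map i := specIntMap (res i.le)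
  map_id U := by
    rw [specIntMap, res_refl, MonoidAlgebra.mapDomainRingHom_id]
    exact Spec.map_id _
  map_comp {U V W} i j := by
    have : res (X := X.toMonoidalSpace) (i ≫ j).le = (res i.le).comp (res j.le) :=
      MonoidHom.ext fun s => (res_res _ _ s).symm
    rw [specIntMap, this, MonoidAlgebra.mapDomainRingHom_comp, CommRingCat.ofHom_comp,
      Spec.map_comp]

instance {U V : X.AffineOpens} (i : U ⟶ V) : IsOpenImmersion (X.intDiagram.map i) := by
  obtain ⟨f, hf⟩ := V.2.exists_isLocalizationMap U.2 i.le
  exact isOpenImmersion_specIntMap hf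

instance : (X.intDiagram ⋙ AlgebraicGeometry.Scheme.forget).IsLocallyDirected where
  cond {V V' U} i i' x x' hx := by
    obtain ⟨hW, f, f', hf, hf', hff'⟩ := U.2.inter V.2 V'.2 i.le i'.le
    let W : X.AffineOpens := ⟨V.1 ⊓ V'.1, hW⟩
    let k : W ⟶ V := homOfLE (inf_le_left : V.1 ⊓ V'.1 ≤ V.1)
    let k' : W ⟶ V' := homOfLE (inf_le_right : V.1 ⊓ V'.1 ≤ V'.1)
    have hx' : X.intDiagram.map i x = X.intDiagram.map i' x' := hx
    have hy : X.intDiagram.map i x ∈ Set.range (X.intDiagram.map (k ≫ i)) := by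
      have h₁ : X.intDiagram.map i x ∈ Set.range (X.intDiagram.map i) := ⟨x, rfl⟩
      have h₂ : X.intDiagram.map i x ∈ Set.range (X.intDiagram.map i') := ⟨x', hx'.symm⟩
      have e₁ := range_specIntMap hf
      have e₂ := range_specIntMap hf'
      have e₃ := range_specIntMap hff'
      refine e₃.ge ?_
      rw [map_mul, PrimeSpectrum.basicOpen_mul]
      exact ⟨e₁.le h₁, e₂.le h₂⟩
    obtain ⟨w, hw⟩ := hy
    have hw' : X.intDiagram.map (k' ≫ i') w = X.intDiagram.map i' x' := hw.trans hx'
    rw [Functor.map_comp, AlgebraicGeometry.Scheme.Hom.comp_apply] at hw hw'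
    exact ⟨W, k, k', w, (X.intDiagram.map i).isOpenEmbedding.injective hw,
      (X.intDiagram.map i').isOpenEmbedding.injective hw'⟩

/-- The base extension `X ⊗_{𝔽₁} ℤ`: the scheme glued from the affine schemes `Spec ℤ[𝒪_X(U)]`,
`U ⊆ X` affine open, along the inclusions of affine open subsets. -/
def baseExtension : AlgebraicGeometry.Scheme.{u} := Limits.colimit X.intDiagram

end Scheme

/-! ### Zeta functions -/

section Zeta

/-- The formal power series `exp (∑_{n ≥ 1} N(n) T ^ n / n)`. -/
def expSeries (N : ℕ → ℕ) : PowerSeries ℚ :=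
  (PowerSeries.exp ℚ).subst
    (PowerSeries.mk fun n => if n = 0 then 0 else (N n : ℚ) / n : PowerSeries ℚ)

variable (p : ℕ) [Fact p.Prime]

/-- The field with `p` elements. -/
abbrev Fp : CommRingCat.{u} := CommRingCat.of (ULift.{u} (ZMod p))

/-- The field with `p ^ n` elements (`n ≥ 1`). -/
abbrev Fq (n : ℕ) : CommRingCat.{u} := CommRingCat.of (ULift.{u} (GaloisField p n))

/-- The homomorphism `𝔽_p → 𝔽_{p ^ n}`. -/
def FpToFq (n : ℕ) : Fp.{u} p ⟶ Fq.{u} p n :=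
  CommRingCat.ofHom (ULift.ringEquiv.symm.toRingHom.comp
    ((algebraMap (ZMod p) (GaloisField p n)).comp ULift.ringEquiv.toRingHom))

/-- The multiplicative monoid `(R, ×)` of a ring. -/
abbrev multMonoid (R : CommRingCat.{u}) : CommMonCat.{u} := CommMonCat.of R

/-- `Z_X(p, T) = exp (∑_{n ≥ 1} #X((𝔽_{p ^ n}, ×)) T ^ n / n)`. -/
def Scheme.zeta (X : Scheme.{u}) : PowerSeries ℚ :=
  expSeries fun n => Nat.card (X.Points (multMonoid (Fq.{u} p n)))

/-- The base extension `X ⊗_{𝔽₁} 𝔽_p = (X ⊗_{𝔽₁} ℤ) ×_{Spec ℤ} Spec 𝔽_p`, a scheme over `𝔽_p`. -/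
def Scheme.baseExtensionFp (X : Scheme.{u}) : Over (Spec (Fp.{u} p)) :=
  Over.mk (Limits.pullback.snd (specULiftZIsTerminal.from X.baseExtension)
    (specULiftZIsTerminal.from (Spec (Fp.{u} p))))

/-- The set `Y(𝔽_{p ^ n})` of `𝔽_{p ^ n}`-valued points of a scheme `Y` over `𝔽_p`: morphisms
`Spec 𝔽_{p ^ n} → Y` over `𝔽_p`. -/
def PointsOver (Y : Over (Spec (Fp.{u} p))) (n : ℕ) : Type u :=
  Over.mk (Spec.map (FpToFq.{u} p n)) ⟶ Y

/-- The Hasse–Weil zeta function `Z(Y, T) = exp (∑_{n ≥ 1} #Y(𝔽_{p ^ n}) T ^ n / n)` of a scheme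
`Y` over `𝔽_p` with finitely many `𝔽_{p ^ n}`-valued points for every `n ≥ 1`. -/
def hasseWeilZeta (Y : Over (Spec (Fp.{u} p))) : PowerSeries ℚ :=
  expSeries fun n => Nat.card (PointsOver p Y n)

end Zeta

end

end FOne

namespace FOne

noncomputable section

/-! ### Evaluation of sections along morphisms from a spectrum -/

section Eval

open PrimeIdeal

/-! Everything reduces to a bijection `X((K, ×)) ≃ (X ⊗ ℤ)(K)` for an arbitrary field `K`: taking `K
= 𝔽_{p^n}` transfers finiteness and makes the two counting functions equal, hence the two
exponential series.

Both sides are quotients of one set, the pairs `(U, φ)` with `U ⊆ X` affine open and `φ : 𝒪_X(U) →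
(K, ×)` a monoid homomorphism.

On the monoid side, the spectrum of any monoid `B` has the closed point `B ∖ Bˣ`, whose only open
neighbourhood is the whole space. A morphism `Spec B → X` therefore lands in every affine open `U`
containing the image of that point. Being local, it is determined there by `𝒪_X(U) → B`
(`eq_of_eval_eq`), and every homomorphism occurs (`exists_eval_eq`).

On the ring side, `Spec K` is a single point, so a `K`-point of the glued scheme lies in some chart
`Spec ℤ[𝒪_X(U)]`, where it is a ring homomorphism `ℤ[𝒪_X(U)] → K`, that is, a monoid homomorphism
`𝒪_X(U) → (K, ×)` (`specIntPoint_bijective`).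

In both cases `(U, φ)` and `(V, ψ)` give the same point exactly when both are induced from one
homomorphism on an affine open `W ⊆ U ∩ V` (`toPoint_eq_toPoint_iff`,
`toIntPoint_eq_toIntPoint_iff`). The quotients therefore coincide. Passing from `X ⊗ ℤ` to `X ⊗ 𝔽_p`
is the universal property of the fibre product. -/

/-- A fraction `a / s ∈ A_𝔭` is invertible if and only if `a ∉ 𝔭`. -/
theorem isUnit_mk_iff {A : Type u} [CommMonoid A] {p : PrimeIdeal A} {a : A} {s : p.primeCompl} :
    IsUnit (Localization.mk a s) ↔ a ∉ p.asIdeal := by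
  constructor
  · intro h ha
    obtain ⟨x, hx⟩ := h.exists_right_inv
    induction x using Localization.induction_on with | _ x
    rw [Localization.mk_mul, ← Localization.mk_one, Localization.mk_eq_mk_iff,
      Localization.r_iff_exists] at hx
    obtain ⟨c, hc⟩ := hx
    -- After clearing denominators, one side of the equation contains the factor `a ∈ 𝔭`, while the
    -- other is a product of elements outside `𝔭`.
    have hm : (c : A) * (((1 : p.primeCompl) : A) * (a * x.1)) ∈ p.asIdeal :=
      p.mul_mem_left _ (p.mul_mem_left _ (p.mul_mem_right _ ha))
    rw [hc] at hm
    exact p.primeCompl.mul_mem c.2 (p.primeCompl.mul_mem (s * x.2).2 p.one_notMem) hm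
  · intro ha
    refine IsUnit.of_mul_eq_one (Localization.mk (s : A) ⟨a, ha⟩) ?_
    rw [Localization.mk_mul, ← Localization.mk_one, Localization.mk_eq_mk_iff,
      Localization.r_iff_exists]
    exact ⟨1, by simp [mul_comm]⟩

/-- If `s = a / f` on `V ∋ 𝔭` and the value at `𝔭` is invertible, then `a ∉ 𝔭`, and `f / a` inverts
`s` on all of `V ∩ D(a)`. This makes locality of a morphism checkable on values. -/
theorem isUnitGerm_spec_iff {A : CommMonCat.{u}} {U : Opens (specTop A)} (s : sections A U)
    {p : PrimeIdeal A} (hp : p ∈ U) :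
    IsUnitGerm (X := spec A) (U := U) s p ↔ IsUnit (s.1 ⟨p, hp⟩) := by
  constructor
  · rintro ⟨V, h, hpV, hs⟩
    exact hs.map ((Pi.evalMonoidHom _ ⟨p, hpV⟩).comp (sections A V).subtype)
  · intro hs
    obtain ⟨V, hpV, i, a, f, hV⟩ := s.2 ⟨p, hp⟩
    obtain ⟨hf, e⟩ := hV ⟨p, hpV⟩
    have hs' : IsUnit (s.1 ⟨p, hp⟩) := hs
    rw [show s.1 ⟨p, hp⟩ = _ from e, isUnit_mk_iff] at hs'
    refine ⟨V ⊓ basicOpen a, inf_le_left.trans i.le, ⟨hpV, hs'⟩, ?_⟩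
    refine IsUnit.of_mul_eq_one (M := sections A (V ⊓ basicOpen a))
      ⟨fun q => Localization.mk f ⟨a, q.2.2⟩, fun q => ⟨_, q.2, 𝟙 _, f, a, fun r =>
        ⟨r.2.2, rfl⟩⟩⟩ (Subtype.ext (funext fun q => ?_))
    obtain ⟨hg, e'⟩ := hV ⟨q.1, q.2.1⟩
    refine (congrArg (· * Localization.mk f ⟨a, q.2.2⟩) e').trans ?_
    rw [Localization.mk_mul]
    refine Eq.trans ?_ Localization.mk_one
    rw [Localization.mk_eq_mk_iff, Localization.r_iff_exists]
    exact ⟨1, by simp [mul_comm]⟩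

/-- On a fraction with numerator `a`, both sides say `φ a ∉ 𝔮`. This is the reason `Spec φ` is
local. -/
theorem isUnit_localMap_iff {A B : Type u} [CommMonoid A] [CommMonoid B] (φ : A →* B)
    (q : PrimeIdeal B) (x : Localization (comap φ q).primeCompl) :
    IsUnit (localMap φ (comap φ q) q (comap_compl φ q) x) ↔ IsUnit x := by
  induction x using Localization.induction_on with | _ x
  rw [localMap_mk, isUnit_mk_iff, isUnit_mk_iff, mem_comap]

theorem isLocalMorphism_specMap {A B : Type u} [CommMonoid A] [CommMonoid B] (φ : A →* B) :
    IsLocalMorphism (specMap φ) := by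
  intro q U hq s
  refine (isUnitGerm_spec_iff (A := CommMonCat.of B) _ hq).trans
    (Iff.trans ?_ (isUnitGerm_spec_iff (A := CommMonCat.of A) s hq).symm)
  exact isUnit_localMap_iff φ q _

/-! ### Invertible germs under pullback, and locality of open immersions. -/

variable {X Y Z : MonoidalSpace.{u}}

theorem app_res (f : X ⟶ Y) {U V : Opens Y} (h : V ≤ U) (s : Y.presheaf.obj (op U)) :
    f.hom.c.app (op V) (res h s) =
      res (X := X) ((Opens.map f.hom.base).map (homOfLE h)).le (f.hom.c.app (op U) s) :=
  congr($(f.hom.c.naturality (homOfLE h).op) s)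

/-- This half of locality holds for every morphism, since homomorphisms preserve units; only the
converse is a condition. -/
theorem IsUnitGerm.app (f : X ⟶ Y) {U : Opens Y} {s : Y.presheaf.obj (op U)} {x : X}
    (h : IsUnitGerm s (f.hom.base x)) :
    IsUnitGerm (X := X) (U := (Opens.map f.hom.base).obj U) (f.hom.c.app (op U) s) x := by
  obtain ⟨V, hVU, hx, hs⟩ := h
  refine ⟨(Opens.map f.hom.base).obj V, fun y hy => hVU hy, hx, ?_⟩
  have := hs.map (f.hom.c.app (op V)).hom
  have e := app_res f hVU s
  change IsUnit (res (X := X) _ (f.hom.c.app (op U) s))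
  rw [← e]
  exact this

theorem IsLocalMorphism.comp {f : X ⟶ Y} {g : Y ⟶ Z} (hf : IsLocalMorphism f)
    (hg : IsLocalMorphism g) : IsLocalMorphism (f ≫ g) := fun x U hx s =>
  (hf x ((Opens.map g.hom.base).obj U) hx (g.hom.c.app (op U) s)).trans (hg _ U hx s)

/-- If the pullback of `s` is invertible on `V ∋ x`, then `s` is invertible on the open set `j(V)`,
because `𝒪_Y(j(V)) → 𝒪_X(j⁻¹(j(V)))` is an isomorphism. -/
theorem isLocalMorphism_of_isOpenImmersion (j : X ⟶ Y) [hj : SheafedSpace.IsOpenImmersion j] :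
    IsLocalMorphism j := by
  refine fun x U hx s => ⟨?_, IsUnitGerm.app j⟩
  rintro ⟨V, hV, hxV, hs⟩
  have hW : hj.base_open.isOpenMap.functor.obj V ≤ U := by
    rintro _ ⟨y, hy, rfl⟩
    exact hV hy
  refine ⟨_, hW, ⟨x, hxV, rfl⟩, ?_⟩
  have := hj.c_iso V
  rw [← MulEquiv.isUnit_map
    (asIso (j.hom.c.app (op (hj.base_open.isOpenMap.functor.obj V)))).commMonCatIsoToMulEquiv]
  change IsUnit (j.hom.c.app _ (res hW s))
  rw [app_res]
  have hle : (Opens.map j.hom.base).obj (hj.base_open.isOpenMap.functor.obj V) ≤ V := by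
    rintro y ⟨z, hz, e⟩
    exact hj.base_open.injective e ▸ hz
  have := (hs.map (res (X := X) hle))
  exact (res_res (X := X) hV hle _) ▸ this

/-! ### Values of pulled-back sections, and the closed point of `Spec B`. -/

variable {B : CommMonCat.{u}}

/-- The value in `B_𝔮` of the pullback of a section. -/
def evalAt (f : spec B ⟶ X) (q : PrimeIdeal B) {N : Opens X} (hq : f.hom.base q ∈ N) :
    X.presheaf.obj (op N) →* Localization q.primeCompl :=
  ((Pi.evalMonoidHom (fun r : (Opens.map f.hom.base).obj N =>
      Localization (primeCompl (A := B) r.1)) ⟨q, hq⟩).comp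
    (sections B ((Opens.map f.hom.base).obj N)).subtype).comp (f.hom.c.app (op N)).hom

theorem evalAt_res (f : spec B ⟶ X) (q : PrimeIdeal B) {N N' : Opens X} (h : N' ≤ N)
    (hq : f.hom.base q ∈ N') (s : X.presheaf.obj (op N)) :
    evalAt f q hq (res h s) = evalAt f q (h hq) s :=
  congrArg (fun t : sections B ((Opens.map f.hom.base).obj N') => t.1 ⟨q, hq⟩) (app_res f h s)

/-- The form in which locality is used: the values in `B_𝔮` detect which sections are invertible at
the image of `𝔮`, and in an affine chart this pins down the image point. -/
theorem isUnit_evalAt_iff {f : spec B ⟶ X} (hf : IsLocalMorphism f) {q : PrimeIdeal B}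
    {N : Opens X} (hq : f.hom.base q ∈ N) (s : X.presheaf.obj (op N)) :
    IsUnit (evalAt f q hq s) ↔ IsUnitGerm s (f.hom.base q) :=
  (isUnitGerm_spec_iff _ hq).symm.trans (hf q N hq s)

/-- Morphisms from a spectrum are determined by the values of the pullbacks of sections. -/
theorem hom_ext_evalAt {f g : spec B ⟶ X} (hb : ∀ q : PrimeIdeal B, f.hom.base q = g.hom.base q)
    (h : ∀ (q : PrimeIdeal B) (N : Opens X) (hq : f.hom.base q ∈ N) (hq' : g.hom.base q ∈ N)
      (s : X.presheaf.obj (op N)), evalAt f q hq s = evalAt g q hq' s) : f = g := by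
  obtain ⟨⟨b, c⟩⟩ := f
  obtain ⟨⟨b', c'⟩⟩ := g
  obtain rfl : b = b' := TopCat.hom_ext (ContinuousMap.ext hb)
  congr 2
  ext N s
  exact Subtype.ext (funext fun q => h q.1 N q.2 q.2 s)

/-- The complement of `maxAway 1` consists of the divisors of `1`, which are units, so localizing
there changes nothing. -/
theorem mk_one_bijective (B : Type u) [CommMonoid B] :
    Function.Bijective (Localization.monoidOf (maxAway (1 : B)).primeCompl) := by
  have hu : ∀ s : (maxAway (1 : B)).primeCompl, IsUnit (s : B) := fun s => by
    obtain ⟨n, hn⟩ := notMem_maxAway.mp s.2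
    rw [one_pow] at hn
    exact isUnit_of_dvd_one hn
  refine ⟨fun a b h => ?_, fun x => ?_⟩
  · obtain ⟨c, hc⟩ := (Localization.monoidOf (maxAway (1 : B)).primeCompl).eq_iff_exists.mp h
    exact (hu c).mul_left_cancel hc
  · obtain ⟨⟨a, s⟩, h⟩ := (Localization.monoidOf (maxAway (1 : B)).primeCompl).surj x
    obtain ⟨c, hc⟩ := (hu s).exists_right_inv
    refine ⟨a * c, ?_⟩
    rw [map_mul, ← h, mul_assoc, ← map_mul, hc, map_one, mul_one]

/-- `B ≅ B_𝔪` for the maximal ideal `𝔪 = B ∖ Bˣ`. -/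
def localizationMaxEquiv (B : Type u) [CommMonoid B] :
    B ≃* Localization (maxAway (1 : B)).primeCompl :=
  MulEquiv.ofBijective (Localization.monoidOf (maxAway (1 : B)).primeCompl).toMonoidHom
    (mk_one_bijective B)

theorem localizationMaxEquiv_apply {B : Type u} [CommMonoid B] (b : B) :
    localizationMaxEquiv B b = Localization.mk b 1 :=
  (Localization.mk_one_eq_monoidOf_mk b).symm

/-- The homomorphism `𝒪_X(N) → B` induced by a morphism `Spec B → X` that maps the closed point of
`Spec B` into `N`. -/
def eval (f : spec B ⟶ X) {N : Opens X} (hN : f.hom.base (maxAway (1 : B)) ∈ N) :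
    X.presheaf.obj (op N) →* B :=
  (localizationMaxEquiv B).symm.toMonoidHom.comp (evalAt f _ hN)

theorem eval_res (f : spec B ⟶ X) {N N' : Opens X} (h : N' ≤ N)
    (hN : f.hom.base (maxAway (1 : B)) ∈ N') :
    (eval f hN).comp (res h) = eval f (h hN) :=
  MonoidHom.ext fun s => congrArg (localizationMaxEquiv B).symm (evalAt_res f _ h hN s)

/-- The preimage of `N` is an open set containing the closed point, hence all of `Spec B`. -/
theorem base_mem (f : spec B ⟶ X) {N : Opens X} (hN : f.hom.base (maxAway (1 : B)) ∈ N)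
    (q : PrimeIdeal B) : f.hom.base q ∈ N :=
  (IsChart.eq_top_of_mem (O := (Opens.map f.hom.base).obj N) hN).ge (trivial : q ∈ (⊤ : Opens _))

/-- The pullback of `s` is a section over all of `Spec B = D(1)`, hence `a / 1` for a single `a ∈
B`. Reading it at the closed point identifies `a` with `eval f hN s`, so that one element of `B`
controls the values at all primes. -/
theorem evalAt_eq_mk (f : spec B ⟶ X) {N : Opens X} (hN : f.hom.base (maxAway (1 : B)) ∈ N)
    (q : PrimeIdeal B) (s : X.presheaf.obj (op N)) :
    evalAt f q (base_mem f hN q) s = Localization.mk (eval f hN s) 1 := by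
  have hO : (Opens.map f.hom.base).obj N = basicOpen (1 : B) :=
    (IsChart.eq_top_of_mem (O := (Opens.map f.hom.base).obj N) hN).trans
      (le_antisymm (fun r _ => PrimeIdeal.one_notMem (A := B) r) le_top)
  obtain ⟨a, n, h⟩ := exists_section_eq hO (f.hom.c.app (op N) s)
  have h' : ∀ r : PrimeIdeal B, evalAt f r (base_mem f hN r) s = Localization.mk a 1 := fun r =>
    (h ⟨r, base_mem f hN r⟩).trans (congrArg _ (Subtype.ext (one_pow n)))
  have : eval f hN s = a := by
    rw [← (localizationMaxEquiv B).symm_apply_apply a, localizationMaxEquiv_apply]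
    exact congrArg (localizationMaxEquiv B).symm (h' _)
  rw [h', this]

end Eval

/-! ### Points in an affine open subset -/

section AffinePoints

open PrimeIdeal

variable {X : MonoidalSpace.{u}} {U : Opens X} {A B : CommMonCat.{u}} {j : spec A ⟶ X}

theorem toSection_one (O : Opens (specTop A)) : toSection (A := A) O 1 = 1 :=
  Subtype.ext (funext fun _ => Localization.mk_one)

theorem toSection_top_surjective : Function.Surjective (toSection (A := A) ⊤) := fun s => by
  have htop : (⊤ : Opens (specTop A)) = basicOpen (1 : A) :=
    le_antisymm (fun (q : PrimeIdeal A) _ => PrimeIdeal.one_notMem q) le_top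
  obtain ⟨a, n, h⟩ := exists_section_eq htop s
  exact ⟨a, Subtype.ext (funext fun q =>
    ((h q).trans (congrArg (Localization.mk a) (Subtype.ext (one_pow n)))).symm)⟩

namespace IsChart

theorem toSection_surjective (h : IsChart U A j) : Function.Surjective h.toSection :=
  (res_bijective h.image_top).2.comp ((h.imageIso_bijective ⊤).2.comp toSection_top_surjective)

/-- The homomorphism `A → 𝒪_X(U)` of a chart. -/
def toSectionHom (h : IsChart U A j) : A →* X.presheaf.obj (op U) where
  toFun := h.toSection
  map_one' := by rw [toSection, toSection_one, map_one, map_one]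
  map_mul' := h.toSection_mul

theorem evalAt_toSection (h : IsChart U A j) (p : PrimeIdeal A) (hp : j.hom.base p ∈ U) (a : A) :
    evalAt j p hp (h.toSection a) = Localization.mk a 1 := by
  have := h.isOpenImmersion
  have hp' : j.hom.base p ∈ h.image ⊤ := h.image_top.ge hp
  have e := PresheafedSpace.IsOpenImmersion.invApp_app j.hom ⊤
  have e' : evalAt j p hp' (h.imageIso ⊤ (FOne.toSection ⊤ a)) = Localization.mk a 1 :=
    congrArg (fun t : sections A ((Opens.map j.hom.base).obj (h.image ⊤)) => t.1 ⟨p, hp'⟩)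
      congr($e (FOne.toSection ⊤ a))
  exact (evalAt_res j p h.image_top.ge hp _).trans e'

/-- Recovers the prime `𝔭` from the point `j(𝔭)`, using only invertibility of germs on `X`. -/
theorem isUnitGerm_toSection_iff (h : IsChart U A j) (p : PrimeIdeal A)
    (hp : j.hom.base p ∈ U) (a : A) :
    IsUnitGerm (h.toSection a) (j.hom.base p) ↔ a ∉ p.asIdeal := by
  have := h.isOpenImmersion
  rw [← isUnit_evalAt_iff (isLocalMorphism_of_isOpenImmersion j) hp, h.evalAt_toSection,
    isUnit_mk_iff]

end IsChart

/-- A local morphism `Spec B → X` that maps the closed point into an affine open subset `U` is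
determined by the homomorphism `𝒪_X(U) → B`. -/
theorem eq_of_eval_eq (hU : IsAffineOpen U) {f g : spec B ⟶ X} (hf : IsLocalMorphism f)
    (hg : IsLocalMorphism g) (hfU : f.hom.base (maxAway (1 : B)) ∈ U)
    (hgU : g.hom.base (maxAway (1 : B)) ∈ U) (h : eval f hfU = eval g hgU) : f = g := by
  obtain ⟨A, j, hj⟩ := hU.exists_chart
  -- By locality, the prime of `A` corresponding to `k(𝔮)` is the preimage of `𝔮` under `A → 𝒪_X(U)
  -- → B`; thus `eval` determines the continuous map.
  have key : ∀ {k : spec B ⟶ X} (_ : IsLocalMorphism k)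
      (hkU : k.hom.base (maxAway (1 : B)) ∈ U) (q : PrimeIdeal B) (p : PrimeIdeal A)
      (_ : j.hom.base p = k.hom.base q) (a : A),
      a ∈ p.asIdeal ↔ eval k hkU (hj.toSection a) ∈ q.asIdeal := by
    intro k hk hkU q p e a
    have hq := base_mem k hkU q
    have h₁ := isUnit_evalAt_iff hk hq (hj.toSection a)
    rw [evalAt_eq_mk, isUnit_mk_iff, ← e, hj.isUnitGerm_toSection_iff p (e ▸ hq)] at h₁
    exact (not_iff_not.mp h₁).symm
  have hb : ∀ q : PrimeIdeal B, f.hom.base q = g.hom.base q := by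
    intro q
    obtain ⟨p, hp⟩ := hj.range_eq.ge (base_mem f hfU q)
    obtain ⟨p', hp'⟩ := hj.range_eq.ge (base_mem g hgU q)
    have : p = p' := PrimeIdeal.ext (SetLike.ext fun a => by
      rw [key hf hfU q p hp, key hg hgU q p' hp', h])
    rw [← hp, ← hp', this]
  -- Sections over an arbitrary `N` are compared after restriction to a basic open `D(b) ⊆ U ∩ N`
  -- around the image point.
  refine hom_ext_evalAt hb fun q N hq hq' s => ?_
  obtain ⟨p, hp⟩ := hj.range_eq.ge (base_mem f hfU q)
  obtain ⟨b, hpb, hb'⟩ := PrimeIdeal.exists_basicOpen (A := A)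
    (U := (Opens.map j.hom.base).obj N) (p := p) (by change j.hom.base p ∈ N; rw [hp]; exact hq)
  have hVU : hj.image (basicOpen b) ≤ U := by
    rintro _ ⟨r, -, rfl⟩
    exact hj.range_eq.le ⟨r, rfl⟩
  have hVN : hj.image (basicOpen b) ≤ N := by
    rintro _ ⟨r, hr, rfl⟩
    exact hb' hr
  have hfV : f.hom.base q ∈ hj.image (basicOpen b) := ⟨p, hpb, hp⟩
  have hgV : g.hom.base q ∈ hj.image (basicOpen b) := hb q ▸ hfV
  have hloc := hj.isLocalizationMap_res b rfl hVU
  -- On `D(b)` the section `s` is a fraction `t / d` with `t, d ∈ 𝒪_X(U)`. Both morphisms agree on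
  -- `t` and `d`, and the value of `d` is a unit, so it cancels.
  obtain ⟨⟨t, ⟨d, hd⟩⟩, e⟩ := hloc.surj (res hVN s)
  have hval : ∀ x, evalAt f q hfV (res hVU x) = evalAt g q hgV (res hVU x) := fun x => by
    rw [evalAt_res, evalAt_res, evalAt_eq_mk f hfU, evalAt_eq_mk g hgU, h]
  have hunit : IsUnit (evalAt f q hfV (res hVU d)) := (hloc.map_units ⟨d, hd⟩).map _
  rw [← evalAt_res f q hVN hfV, ← evalAt_res g q hVN hgV]
  refine hunit.mul_right_cancel ?_
  conv_rhs => rw [hval d]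
  rw [← map_mul, ← map_mul]
  exact congr(evalAt f q hfV $e).trans ((hval t).trans congr(evalAt g q hgV $e).symm)

/-- For a chart `j : Spec A → X` onto `U`, the morphism is `Spec B → Spec A → X`, the first map
being induced by `A → 𝒪_X(U) → B`. -/
theorem exists_eval_eq (hU : IsAffineOpen U) (φ : X.presheaf.obj (op U) →* B) :
    ∃ (f : spec B ⟶ X) (_ : IsLocalMorphism f) (hfU : f.hom.base (maxAway (1 : B)) ∈ U),
      eval f hfU = φ := by
  obtain ⟨A, j, hj⟩ := hU.exists_chart
  have := hj.isOpenImmersion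
  let ψ : A →* B := φ.comp hj.toSectionHom
  have hfU : (specMap ψ ≫ j).hom.base (maxAway (1 : B)) ∈ U := hj.range_eq.le ⟨_, rfl⟩
  refine ⟨specMap ψ ≫ j,
    (isLocalMorphism_specMap ψ).comp (isLocalMorphism_of_isOpenImmersion j), hfU, ?_⟩
  ext s
  obtain ⟨a, rfl⟩ := hj.toSection_surjective s
  refine (localizationMaxEquiv B).injective ?_
  refine ((localizationMaxEquiv B).apply_symm_apply _).trans ?_
  rw [localizationMaxEquiv_apply]
  refine (congrArg (localMap ψ (comap ψ (maxAway 1)) (maxAway 1) (comap_compl ψ _))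
    (hj.evalAt_toSection (comap ψ (maxAway (1 : B))) hfU a)).trans ?_
  rw [localMap_mk]
  exact congrArg (Localization.mk _) (Subtype.ext (map_one ψ))

theorem exists_isAffineOpen_le (X : Scheme.{u}) {x : X.toMonoidalSpace}
    {N : Opens X.toMonoidalSpace} (hx : x ∈ N) :
    ∃ V : Opens X.toMonoidalSpace, IsAffineOpen V ∧ x ∈ V ∧ V ≤ N := by
  obtain ⟨U, hxU, hU⟩ := X.exists_isAffineOpen x
  obtain ⟨A, j, hj⟩ := hU.exists_chart
  obtain ⟨p, rfl⟩ := hj.range_eq.ge hxU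
  obtain ⟨f, hpf, hf⟩ := PrimeIdeal.exists_basicOpen (A := A)
    (U := (Opens.map j.hom.base).obj N) (p := p) hx
  refine ⟨_, hj.isAffineOpen_basicOpen f, ⟨p, hpf, rfl⟩, ?_⟩
  rintro _ ⟨r, hr, rfl⟩
  exact hf hr

end AffinePoints

/-! ### Points as glued homomorphisms -/

/-- Pairs of an affine open subset `U` and a homomorphism `𝒪_X(U) → B`. -/
abbrev Scheme.LocalPoint (X : Scheme.{u}) (B : CommMonCat.{u}) : Type u :=
  Σ U : X.AffineOpens, X.toMonoidalSpace.presheaf.obj (op U.1) →* B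

/-- Two homomorphisms `𝒪_X(U) → B` and `𝒪_X(V) → B` agree if they are induced by the same
homomorphism `𝒪_X(W) → B` for some affine open `W ⊆ U ∩ V`. -/
def Scheme.LocalPoint.Agree {X : Scheme.{u}} {B : CommMonCat.{u}} (a b : X.LocalPoint B) : Prop :=
  ∃ (c : X.LocalPoint B) (h : c.1.1 ≤ a.1.1) (h' : c.1.1 ≤ b.1.1),
    c.2.comp (res h) = a.2 ∧ c.2.comp (res h') = b.2

/-- The point of `X` given by a homomorphism `𝒪_X(U) → B`. -/
def Scheme.LocalPoint.toPoint {X : Scheme.{u}} {B : CommMonCat.{u}} (a : X.LocalPoint B) :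
    X.Points B :=
  ⟨(exists_eval_eq a.1.2 a.2).choose, (exists_eval_eq a.1.2 a.2).choose_spec.choose⟩

namespace Scheme.LocalPoint

open PrimeIdeal

variable {X : Scheme.{u}} {B : CommMonCat.{u}}

theorem base_toPoint_mem (a : X.LocalPoint B) :
    a.toPoint.1.hom.base (maxAway (1 : B)) ∈ a.1.1 :=
  (exists_eval_eq a.1.2 a.2).choose_spec.choose_spec.choose

theorem eval_toPoint (a : X.LocalPoint B) : eval a.toPoint.1 a.base_toPoint_mem = a.2 :=
  (exists_eval_eq a.1.2 a.2).choose_spec.choose_spec.choose_spec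

theorem toPoint_eq {a : X.LocalPoint B} {f : X.Points B}
    (hf : f.1.hom.base (maxAway (1 : B)) ∈ a.1.1) (h : eval f.1 hf = a.2) : a.toPoint = f :=
  Subtype.ext (eq_of_eval_eq a.1.2 a.toPoint.2 f.2 a.base_toPoint_mem hf
    (a.eval_toPoint.trans h.symm))

/-- Any affine neighbourhood of the image of the closed point serves as `U`. -/
theorem toPoint_surjective : Function.Surjective (toPoint (X := X) (B := B)) := fun f => by
  obtain ⟨U, hxU, hU⟩ := X.exists_isAffineOpen (f.1.hom.base (maxAway (1 : B)))
  exact ⟨⟨⟨U, hU⟩, eval f.1 hxU⟩, toPoint_eq hxU rfl⟩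

/-- A common point sends the closed point into `U ∩ V`; an affine neighbourhood `W` of its image
there, with evaluation on `W`, witnesses agreement. Conversely, both points equal the one given by
the homomorphism on `W`. -/
theorem toPoint_eq_toPoint_iff {a b : X.LocalPoint B} : a.toPoint = b.toPoint ↔ a.Agree b := by
  constructor
  · intro h
    have hb := b.base_toPoint_mem
    have hb' := b.eval_toPoint
    simp only [← h] at hb hb'
    obtain ⟨W, hW, hxW, hle⟩ := exists_isAffineOpen_le X
      (N := a.1.1 ⊓ b.1.1) ⟨a.base_toPoint_mem, hb⟩
    exact ⟨⟨⟨W, hW⟩, eval a.toPoint.1 hxW⟩, hle.trans inf_le_left, hle.trans inf_le_right,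
      (eval_res _ _ hxW).trans a.eval_toPoint, (eval_res _ _ hxW).trans hb'⟩
  · rintro ⟨c, h, h', e, e'⟩
    refine (toPoint_eq (h c.base_toPoint_mem) ?_).trans
      (toPoint_eq (h' c.base_toPoint_mem) ?_).symm
    · rw [← eval_res _ h c.base_toPoint_mem, eval_toPoint, e]
    · rw [← eval_res _ h' c.base_toPoint_mem, eval_toPoint, e']

end Scheme.LocalPoint

/-! ### Points of the base extension -/

section FieldPoints

open AlgebraicGeometry.Scheme

variable {K : Type u} [Field K]

/-- The morphism `Spec K → Spec ℤ[M]` given by a homomorphism `M → (K, ×)`. -/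
def specIntPoint {M : Type u} [CommMonoid M] (φ : M →* K) :
    Spec (CommRingCat.of K) ⟶ Spec (CommRingCat.of (MonoidAlgebra ℤ M)) :=
  Spec.map (CommRingCat.ofHom (MonoidAlgebra.lift ℤ K M φ).toRingHom)

/-- Full faithfulness of `Spec` combined with the universal property of the monoid ring; the
restriction to the coefficients `ℤ` is forced. -/
theorem specIntPoint_bijective {M : Type u} [CommMonoid M] :
    Function.Bijective (specIntPoint (K := K) (M := M)) := by
  constructor
  · intro φ ψ h
    have h' := congr(($(Spec.map_injective h)).hom)
    ext m
    simpa using congr($h' (MonoidAlgebra.of ℤ M m))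
  · intro f
    obtain ⟨g, rfl⟩ := Spec.map_surjective f
    refine ⟨(g.hom : MonoidAlgebra ℤ M →* K).comp (MonoidAlgebra.of ℤ M), ?_⟩
    refine congrArg Spec.map (CommRingCat.hom_ext ?_)
    refine MonoidAlgebra.ringHom_ext' (Subsingleton.elim _ _) (MonoidHom.ext fun m => ?_)
    simp

theorem specIntPoint_comp {M N : Type u} [CommMonoid M] [CommMonoid N] (φ : M →* N)
    (ψ : N →* K) : specIntPoint ψ ≫ specIntMap φ = specIntPoint (ψ.comp φ) := by
  rw [specIntPoint, specIntPoint, specIntMap, ← Spec.map_comp]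
  refine congrArg Spec.map (CommRingCat.hom_ext ?_)
  refine MonoidAlgebra.ringHom_ext' (Subsingleton.elim _ _) (MonoidHom.ext fun m => ?_)
  simp

/-- A morphism from the spectrum of a field lifts along an open immersion whose image contains a
point of its image. -/
theorem exists_lift_of_mem_range {Y Z : AlgebraicGeometry.Scheme.{u}} (i : Y ⟶ Z)
    [IsOpenImmersion i] (g : Spec (CommRingCat.of K) ⟶ Z) {x : Spec (CommRingCat.of K)}
    (hx : g x ∈ Set.range i) : ∃ g', g' ≫ i = g := by
  have : Subsingleton (Spec (CommRingCat.of K)) :=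
    inferInstanceAs (Subsingleton (PrimeSpectrum K))
  refine ⟨IsOpenImmersion.lift i g ?_, IsOpenImmersion.lift_fac i g _⟩
  rintro _ ⟨y, rfl⟩
  rwa [Subsingleton.elim y x]

variable {X : FOne.Scheme.{u}}

/-- The `K`-valued point of `X ⊗ ℤ` given by a homomorphism `𝒪_X(U) → (K, ×)`. -/
def Scheme.LocalPoint.toIntPoint (a : X.LocalPoint (CommMonCat.of K)) :
    Spec (CommRingCat.of K) ⟶ X.baseExtension :=
  specIntPoint a.2 ≫ Limits.colimit.ι X.intDiagram a.1

theorem Scheme.LocalPoint.toIntPoint_surjective :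
    Function.Surjective (toIntPoint (X := X) (K := K)) := fun g => by
  let x : Spec (CommRingCat.of K) := (⊥ : PrimeSpectrum K)
  obtain ⟨U, y, hy⟩ := IsLocallyDirected.ι_jointly_surjective X.intDiagram (g x)
  obtain ⟨g', rfl⟩ := exists_lift_of_mem_range (Limits.colimit.ι X.intDiagram U) g ⟨y, hy⟩
  obtain ⟨φ, rfl⟩ := specIntPoint_bijective.2 g'
  exact ⟨⟨U, φ⟩, rfl⟩

/-- The gluing diagram is locally directed, so points of two charts with the same image come from a
point of a smaller chart `W`. Since `Spec K` is one point, the whole morphism then factors through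
`W`. -/
theorem Scheme.LocalPoint.toIntPoint_eq_toIntPoint_iff {a b : X.LocalPoint (CommMonCat.of K)} :
    a.toIntPoint = b.toIntPoint ↔ a.Agree b := by
  have hcomp : ∀ {U V : X.AffineOpens} (h : V ≤ U)
      (φ : X.toMonoidalSpace.presheaf.obj (op V.1) →* K),
      specIntPoint (φ.comp (res h)) ≫ Limits.colimit.ι X.intDiagram U =
        specIntPoint φ ≫ Limits.colimit.ι X.intDiagram V := fun {U V} h φ => by
    rw [← specIntPoint_comp]
    exact (Category.assoc _ _ _).trans (congrArg (specIntPoint φ ≫ ·)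
      (Limits.colimit.w X.intDiagram (homOfLE h)))
  constructor
  · intro h
    let x : Spec (CommRingCat.of K) := (⊥ : PrimeSpectrum K)
    have hx : Limits.colimit.ι X.intDiagram a.1 (specIntPoint a.2 x) =
        Limits.colimit.ι X.intDiagram b.1 (specIntPoint b.2 x) := congr($h x)
    obtain ⟨W, i, i', y, hy, -⟩ := (IsLocallyDirected.ι_eq_ι_iff X.intDiagram).mp hx
    obtain ⟨g, hg⟩ := exists_lift_of_mem_range (X.intDiagram.map i) (specIntPoint a.2) ⟨y, hy⟩
    obtain ⟨φ, rfl⟩ := specIntPoint_bijective.2 g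
    have e : φ.comp (res i.le) = a.2 :=
      specIntPoint_bijective.1 ((specIntPoint_comp _ _).symm.trans hg)
    refine ⟨⟨W, φ⟩, i.le, i'.le, e, specIntPoint_bijective.1 ?_⟩
    -- The lift to `W` was chosen for `a` only. It also induces `b`, because the chart of `b` is an
    -- open immersion, hence a monomorphism, and the composites into the colimit agree.
    refine (cancel_mono (Limits.colimit.ι X.intDiagram b.1)).mp ?_
    refine (hcomp i'.le φ).trans ((hcomp i.le φ).symm.trans ?_)
    rw [e]
    exact h
  · rintro ⟨c, h, h', e, e'⟩
    rw [toIntPoint, toIntPoint, ← e, ← e']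
    exact (hcomp h c.2).trans (hcomp h' c.2).symm

/-- `X(𝔽_K) ≅ (X ⊗ ℤ)(K)` for the multiplicative monoid of a field `K`. -/
def Scheme.pointsEquivInt (X : FOne.Scheme.{u}) (K : Type u) [Field K] :
    X.Points (CommMonCat.of K) ≃ (Spec (CommRingCat.of K) ⟶ X.baseExtension) :=
  -- Both maps out of `LocalPoint` are surjective with the same kernel relation `Agree`.
  (Setoid.quotientKerEquivOfSurjective _ Scheme.LocalPoint.toPoint_surjective).symm.trans
    ((Quotient.congrRight fun _ _ => Scheme.LocalPoint.toPoint_eq_toPoint_iff.trans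
      Scheme.LocalPoint.toIntPoint_eq_toIntPoint_iff.symm).trans
      (Setoid.quotientKerEquivOfSurjective _ Scheme.LocalPoint.toIntPoint_surjective))

end FieldPoints

/-- The points over `𝔽_p` of `X ⊗ 𝔽_p` are the points of `X ⊗ ℤ`. -/
def pointsOverEquiv (p : ℕ) [Fact p.Prime] (X : Scheme.{u}) (n : ℕ) :
    PointsOver p (X.baseExtensionFp p) n ≃ (Spec (Fq.{u} p n) ⟶ X.baseExtension) where
  toFun f := f.left ≫ Limits.pullback.fst _ _
  -- The square needed for the lift commutes because `Spec ℤ` is terminal; the second component is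
  -- forced by being over `𝔽_p`.
  invFun g := Over.homMk (Limits.pullback.lift g (Spec.map (FpToFq p n))
    (specULiftZIsTerminal.hom_ext _ _)) (Limits.pullback.lift_snd _ _ _)
  left_inv f := Over.OverMorphism.ext (Limits.pullback.hom_ext (Limits.pullback.lift_fst _ _ _)
    ((Limits.pullback.lift_snd _ _ _).trans (Over.w f).symm))
  right_inv _ := Limits.pullback.lift_fst _ _ _

/-- `X((𝔽_{p ^ n}, ×)) ≅ (X ⊗ 𝔽_p)(𝔽_{p ^ n})`. -/
def Scheme.pointsEquiv (p : ℕ) [Fact p.Prime] (X : Scheme.{u}) (n : ℕ) :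
    X.Points (multMonoid (Fq.{u} p n)) ≃ PointsOver p (X.baseExtensionFp p) n :=
  (X.pointsEquivInt (ULift.{u} (GaloisField p n))).trans (pointsOverEquiv p X n).symm

end

end FOne

theorem mainTheorem12 (p : ℕ) [Fact p.Prime] (X : FOne.Scheme.{u})
    (hX : ∀ n : ℕ, 1 ≤ n → Finite (X.Points (FOne.multMonoid (FOne.Fq.{u} p n)))) :
    (∀ n : ℕ, 1 ≤ n → Finite (FOne.PointsOver p (X.baseExtensionFp p) n)) ∧
      X.zeta p = FOne.hasseWeilZeta p (X.baseExtensionFp p) := by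
  refine ⟨fun n hn => ?_, ?_⟩
  · have := hX n hn
    exact Finite.of_equiv _ (X.pointsEquiv p n)
  -- The bijection exists for every `n`, including `n = 0`, so the counting functions agree
  -- everywhere and the discarded index `0` needs no separate case.
  · exact congrArg FOne.expSeries (funext fun n => Nat.card_congr (X.pointsEquiv p n))
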